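/- **Setting.** All position indices are taken mod $d$. Let $d\ge 1$, $\tau\in S_d$, external dimensions $\vec n=(n_1,\dots,n_d)$, bond dimensions $\vec r=(r_1,\dots,r_d)$, and $3$-tensors $u^{i}\in\mathbb R^{r_{\tau^{-1}(i)}\times n_i\times r_{\tau^{-1}(i)+1}}$, $1\le i\le d$. The associated tensor in tensor ring format is $$\mathbf T(x_1,\dots,x_d)=\operatorname{tr}\bigl(u^{\tau(1)}(x_{\tau(1)})\cdots u^{\tau(d)}(x_{\tau(d)})\bigr),\qquad u^{i}(x_i):=u^{i}(:,x_i,:),\quad 1\le x_i\le n_i .$$ Four different indices $(i_1,i_2,i_3,i_4)$ are of the *correct order* with respect to $\tau$ if for some cyclic rotation $(a,b,c,e)$ of $(i_1,i_2,i_3,i_4)$ either $\tau^{-1}(a)<\tau^{-1}(b)<\tau^{-1}(c)<\tau^{-1}(e)$ or $\tau^{-1}(a)>\tau^{-1}(b)>\tau^{-1}(c)>\tau^{-1}(e)$. For a tensor $\mathbf X\in\mathbb R^{n_1\times\cdots\times n_d}$, different indices $a,b,c,e$ and fixed $y_j\in\{1,\dots,n_j\}$ for $j\notin\{a,b,c,e\}$,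 let $M_{(a,b),(c,e)}(\mathbf X)\in\mathbb R^{(n_an_b)\times(n_cn_e)}$ be the matrix whose entry in row $(x_a,x_b)$ and column $(x_c,x_e)$ is the entry of $\mathbf X$ with indices $x_a,x_b,x_c,x_e$ in positions $a,b,c,e$ and $y_j$ in every other position $j$. Let $\sigma_k(M)$ be the $k$-th largest singular value of $M$. **Algorithm 1.** Given $R$, four different indices $i_1,\dots,i_4$, the values $y_j$ and an observed tensor $\mathbf X$, let $s_1,s_2,s_3$ be $\sigma_{R^4}$ of $M_{(i_1,i_2),(i_3,i_4)}(\mathbf X)$, $M_{(i_1,i_3),(i_2,i_4)}(\mathbf X)$, $M_{(i_1,i_4),(i_2,i_3)}(\mathbf X)$. Return $(i_1,i_3,i_2,i_4)$ if $s_1>\max\{s_2,s_3\}$, $(i_1,i_2,i_3,i_4)$ if $s_2>\max\{s_1,s_3\}$, $(i_1,i_2,i_4,i_3)$ if $s_3>\max\{s_1,s_2\}$, and nothing otherwise. **Theorem 4.5.** Let the positive integer $R$ satisfy $$\min_{i}n_i\ \ge\ R^2\ >\ \max_j r_j,\qquad \min_j r_j\ge R ,$$ and let $\sigma>0$ be such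 that $\sigma_{R^4}\bigl(M_{(i_1,i_3),(i_2,i_4)}(\mathbf T)\bigr)\ge\sigma$ for all $(i_1,i_2,i_3,i_4)$ of the correct order with respect to $\tau$ and all values of the fixed $y_j$, $j\notin\{i_1,i_2,i_3,i_4\}$. Let $\sigma_e>0$, let the entries of $\mathbf T$ be observed with independent $\mathcal N(0,\sigma_e^2)$ noise, and put $n_{\max}=\max_i n_i$. Then for every real $T<\sigma/\sigma_e$, any four different indices $i_1,i_2,i_3,i_4\in\{1,\dots,d\}$ and any $y_j\in\{1,\dots,n_j\}$, $j\notin\{i_1,i_2,i_3,i_4\}$, the probability that Algorithm 1, run on the observed tensor, fails to return an ordering of $i_1,i_2,i_3,i_4$ that is of the correct order with respect to $\tau$ is at most $$6\exp\Bigl(-\tfrac18\max\{T-4n_{\max},0\}^2\Bigr).$$ -/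

import Mathlib

open MeasureTheory ProbabilityTheory

namespace TensorRing

/-- Real tensors with external (physical) dimensions `n`: arrays with one real entry for each
multi-index `(x_1, …, x_d)`, where `x_i` ranges over `n i` values. -/
abbrev Tensor {d : ℕ} (n : Fin d → ℕ) : Type :=
  (∀ i : Fin d, Fin (n i)) → ℝ

/-- Collections of `3`-tensors for the tensor ring format with external dimensions `n`,
internal (bond) dimensions `r` and permutation `τ`: the `i`-th core has size
`r (τ⁻¹ i) × n i × r (τ⁻¹ i + 1)`. Addition in `Fin d` is modulo `d`. -/
abbrev Cores {d : ℕ} [NeZero d] (r n : Fin d → ℕ) (τ : Equiv.Perm (Fin d)) : Type :=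
  ∀ i : Fin d, Fin (r (τ.symm i)) → Fin (n i) → Fin (r (τ.symm i + 1)) → ℝ

/-- The tensor in tensor ring format built from the cores `u` and the permutation `τ`: its entry at
`x` is the trace of the product of the matrices `u (τ j) (·, x (τ j), ·)`, `j = 1, …, d`, that is,
the sum over all bond indices `k` of
`∏ j, u (τ j) (k j, x (τ j), k (j + 1))`; the product is written over `i = τ j`. -/
def ringTensor {d : ℕ} [NeZero d] {r n : Fin d → ℕ} (τ : Equiv.Perm (Fin d))
    (u : Cores r n τ) : Tensor n :=
  fun x => ∑ k : (∀ j : Fin d, Fin (r j)),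
    ∏ i : Fin d, u i (k (τ.symm i)) (x i) (k (τ.symm i + 1))

/-- Four indices are of the correct order with respect to `τ` if, up to a cyclic rotation, their
positions under `τ⁻¹` are strictly increasing or strictly decreasing. Subscripts are mod `4`. -/
def CorrectOrder {d : ℕ} (τ : Equiv.Perm (Fin d)) (i : Fin 4 → Fin d) : Prop :=
  ∃ s : Fin 4,
    (τ.symm (i s) < τ.symm (i (s + 1)) ∧ τ.symm (i (s + 1)) < τ.symm (i (s + 2)) ∧
      τ.symm (i (s + 2)) < τ.symm (i (s + 3))) ∨
    (τ.symm (i s) > τ.symm (i (s + 1)) ∧ τ.symm (i (s + 1)) > τ.symm (i (s + 2)) ∧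
      τ.symm (i (s + 2)) > τ.symm (i (s + 3)))

/-- The down-sampled matricization `M_{(a,b),(c,e)}` of the tensor `X`: rows are indexed by
`(x_a, x_b)`, columns by `(x_c, x_e)`, and every other index `j` is frozen at `y j`
(the values of `y` at `a, b, c, e` play no role). -/
def matricization {d : ℕ} {n : Fin d → ℕ} (X : Tensor n) (y : ∀ j : Fin d, Fin (n j))
    (a b c e : Fin d) : Matrix (Fin (n a) × Fin (n b)) (Fin (n c) × Fin (n e)) ℝ :=
  Matrix.of fun p q =>
    X (Function.update (Function.update (Function.update (Function.update y
      a p.1) b p.2) c q.1) e q.2)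

/-- The `k`-th largest singular value (`k ≥ 1`) of a real matrix. Mathlib's sequence of singular
values is indexed from `0`. -/
noncomputable def singularValue {l m : Type*} [Fintype l] [Fintype m] [DecidableEq m]
    (k : ℕ) (M : Matrix l m ℝ) : ℝ :=
  (Matrix.toEuclideanLin M).singularValues (k - 1)

open Classical in
/-- The algorithm that orders four indices `i 0, i 1, i 2, i 3`. Its inputs are the integer `R`,
the four indices, the sampled values `y` at which the other indices are frozen, and the
(possibly noisy) tensor `X` whose entries the oracle returns. It compares the `R ^ 4`-th largest
singular values of the three matricizations, and returns nothing when there is no strict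
maximum. -/
noncomputable def fourIndexAlgorithm {d : ℕ} {n : Fin d → ℕ} (R : ℕ) (i : Fin 4 → Fin d)
    (y : ∀ j : Fin d, Fin (n j)) (X : Tensor n) : Option (Fin 4 → Fin d) :=
  let s₁ := singularValue (R ^ 4) (matricization X y (i 0) (i 1) (i 2) (i 3))
  let s₂ := singularValue (R ^ 4) (matricization X y (i 0) (i 2) (i 1) (i 3))
  let s₃ := singularValue (R ^ 4) (matricization X y (i 0) (i 3) (i 1) (i 2))
  if s₁ > max s₂ s₃ then some ![i 0, i 2, i 1, i 3]
  else if s₂ > max s₁ s₃ then some ![i 0, i 1, i 2, i 3]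
  else if s₃ > max s₁ s₂ then some ![i 0, i 1, i 3, i 2]
  else none

/-- The relation required between the input `R`, the external dimensions `n` and the bond
dimensions `r`: `min n ≥ R² > max r` and `min r ≥ R`, with `R` positive. -/
def DimensionCondition {d : ℕ} (R : ℕ) (r n : Fin d → ℕ) : Prop :=
  0 < R ∧ (∀ i, R ^ 2 ≤ n i) ∧ (∀ j, r j < R ^ 2) ∧ (∀ j, R ≤ r j)

/-- `σ` bounds from below the `R ^ 4`-th largest singular value of `M_{(i₁,i₃),(i₂,i₄)}`, uniformly
over all `(i₁, i₂, i₃, i₄)` of the correct order and all values of the frozen indices. -/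
def UniformSingularValueBound {d : ℕ} {n : Fin d → ℕ} (τ : Equiv.Perm (Fin d)) (X : Tensor n)
    (R : ℕ) (σ : ℝ) : Prop :=
  ∀ i : Fin 4 → Fin d, CorrectOrder τ i → ∀ y : (∀ j : Fin d, Fin (n j)),
    σ ≤ singularValue (R ^ 4) (matricization X y (i 0) (i 2) (i 1) (i 3))

end TensorRing

open TensorRing

/-! If the order is correct, the indices of each of the pairs $(i_1,i_2)$, $(i_3,i_4)$, $(i_1,i_4)$,
$(i_2,i_3)$ are neighbours on the ring of four. Cutting the ring at two bonds then separates the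
rows of the matricization from its columns, so its rank is at most $r_s r_t<R^4$ and its $R^4$-th
singular value vanishes (`rank_matricization_lt`, `singularValue_eq_zero_of_rank_lt`). The crossing
pairing has $\sigma_{R^4}\ge\sigma$ by hypothesis. Weyl's inequality (`singularValues_le_add`) moves
each value by at most the operator norm $\varepsilon$ of the noise matricization, so the crossing
value stays the strict maximum when $2\varepsilon<\sigma$ (`fourIndexAlgorithm_correct`).

It remains to bound the norm of a Gaussian matrix $G$ (`measureReal_norm_gaussianMatrix_le`). The
proof is a Slepian-type comparison at the level of exponential moments, which gives the tail
$e^{-t^2/2}$ directly, with no separate concentration theorem. For unit vectors, $X_{u,v}=\langle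
Gv,u\rangle+\gamma$ and $Y_{u,v}=\langle g,u\rangle+\langle h,v\rangle$ have equal variances, and
their covariances differ by $(1-\langle u,u'\rangle)(1-\langle v,v'\rangle)\ge0$. Rotating one
family into the other and integrating by parts compares the expectations of $(\sum_i e^{tX_i/p})^p$
and $(\sum_i e^{tY_i/p})^p$ (`integral_sum_exp_rpow_le`). For $N$ pairs this quantity lies between
$e^{t\max X}$ and $N^pe^{t\max X}$; letting $p\to0$ removes $N$, so the bound passes to a dense
sequence of pairs. -/

namespace TensorRing

/-! ### Gaussian integration by parts, and a class of integrable functions to apply it to. -/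

section GaussianIntegration

theorem integrable_gaussianReal_iff {f : ℝ → ℝ} :
    Integrable f (gaussianReal 0 1) ↔ Integrable (fun x => gaussianPDFReal 0 1 x * f x) := by
  rw [gaussianReal_of_var_ne_zero _ one_ne_zero,
    integrable_withDensity_iff_integrable_smul' (measurable_gaussianPDF _ _)
      (ae_of_all _ fun _ => gaussianPDF_lt_top)]
  simp [toReal_gaussianPDF]

theorem hasDerivAt_gaussianPDFReal (x : ℝ) :
    HasDerivAt (gaussianPDFReal 0 1) (-x * gaussianPDFReal 0 1 x) x := by
  have h : HasDerivAt (fun x : ℝ => -(x - 0) ^ 2 / (2 * ((1 : NNReal) : ℝ))) (-x) x := by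
    have := (((hasDerivAt_id x).sub_const 0).pow 2).neg.div_const (2 * ((1 : NNReal) : ℝ))
    refine (this.congr_deriv ?_)
    simp
    ring
  rw [gaussianPDFReal_def]
  refine (h.exp.const_mul _).congr_deriv ?_
  ring

/-- Gaussian integration by parts on the real line. -/
theorem integral_id_mul_gaussianReal {h h' : ℝ → ℝ} (hd : ∀ t, HasDerivAt h (h' t) t)
    (h₀ : Integrable h (gaussianReal 0 1))
    (h₁ : Integrable (fun t => t * h t) (gaussianReal 0 1))
    (h₂ : Integrable h' (gaussianReal 0 1)) :
    ∫ t, t * h t ∂gaussianReal 0 1 = ∫ t, h' t ∂gaussianReal 0 1 := by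
  rw [integrable_gaussianReal_iff] at h₀ h₁ h₂
  rw [integral_gaussianReal_eq_integral_smul one_ne_zero,
    integral_gaussianReal_eq_integral_smul one_ne_zero]
  have key := integral_mul_deriv_eq_deriv_mul_of_integrable (u := h) (v := gaussianPDFReal 0 1)
    (u' := h') (v' := fun x => -x * gaussianPDFReal 0 1 x) (fun x _ => hd x)
    (fun x _ => hasDerivAt_gaussianPDFReal x)
    (by refine h₁.neg.congr (ae_of_all _ fun x => ?_); simp; ring)
    (by refine h₂.congr (ae_of_all _ fun x => ?_); simp; ring)
    (by refine h₀.congr (ae_of_all _ fun x => ?_); simp; ring)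
  have e₁ : ∫ x, h x * (-x * gaussianPDFReal 0 1 x)
      = -∫ x, gaussianPDFReal 0 1 x • (x * h x) := by
    rw [← integral_neg]; congr 1; ext x; simp; ring
  have e₂ : ∫ x, h' x * gaussianPDFReal 0 1 x = ∫ x, gaussianPDFReal 0 1 x • h' x := by
    congr 1; ext x; simp; ring
  linarith

variable {κ : Type*} [Fintype κ]

/-- The standard Gaussian measure on `κ → ℝ`. -/
noncomputable abbrev stdGauss (κ : Type*) [Fintype κ] : Measure (κ → ℝ) :=
  Measure.pi fun _ => gaussianReal 0 1

/-- Resampling one coordinate by an independent Gaussian preserves the product measure. Fubini can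
thus isolate the coordinate `k` without splitting the index type. -/
theorem measurePreserving_update [DecidableEq κ] (k : κ) :
    MeasurePreserving (fun q : (κ → ℝ) × ℝ => Function.update q.1 k q.2)
      ((stdGauss κ).prod (gaussianReal 0 1)) (stdGauss κ) where
  measurable := by fun_prop
  map_eq := by
    refine (Measure.pi_eq fun s hs => ?_).symm
    rw [Measure.map_apply (by fun_prop) (MeasurableSet.univ_pi hs)]
    have : (fun q : (κ → ℝ) × ℝ => Function.update q.1 k q.2) ⁻¹' Set.univ.pi s
        = (Set.univ.pi (Function.update s k Set.univ)) ×ˢ s k := by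
      ext q
      simp only [Set.mem_preimage, Set.mem_pi, Set.mem_univ, true_implies, Set.mem_prod]
      constructor
      · intro h
        refine ⟨fun j => ?_, by simpa using h k⟩
        by_cases hj : j = k
        · subst hj; simp
        · simpa [hj] using h j
      · rintro ⟨h, hk⟩ j
        by_cases hj : j = k
        · subst hj; simpa using hk
        · simpa [hj] using h j
    rw [this, Measure.prod_prod, Measure.pi_pi,
      ← Finset.mul_prod_erase Finset.univ (fun i => gaussianReal 0 1 (s i)) (Finset.mem_univ k),
      ← Finset.mul_prod_erase Finset.univ
        (fun i => gaussianReal 0 1 (Function.update s k Set.univ i)) (Finset.mem_univ k)]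
    rw [Finset.prod_congr rfl (g := fun i => gaussianReal 0 1 (s i))
      (fun i hi => by simp [Finset.ne_of_mem_erase hi])]
    simp [mul_comm]

/-- Gaussian integration by parts in the coordinate `k`. -/
theorem integral_coord_mul_stdGauss [DecidableEq κ] (k : κ) {H D : (κ → ℝ) → ℝ}
    (hd : ∀ w t, HasDerivAt (fun t => H (Function.update w k t)) (D (Function.update w k t)) t)
    (h₀ : Integrable H (stdGauss κ)) (h₁ : Integrable (fun w => w k * H w) (stdGauss κ))
    (h₂ : Integrable D (stdGauss κ)) :
    ∫ w, w k * H w ∂stdGauss κ = ∫ w, D w ∂stdGauss κ := by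
  have mp := measurePreserving_update (κ := κ) k
  have i₀ := (mp.integrable_comp h₀.aestronglyMeasurable).2 h₀
  have i₁ := (mp.integrable_comp h₁.aestronglyMeasurable).2 h₁
  have i₂ := (mp.integrable_comp h₂.aestronglyMeasurable).2 h₂
  simp only [Function.comp_def] at i₀ i₁ i₂
  have c (f : (κ → ℝ) → ℝ) (hf : Integrable f (stdGauss κ)) : ∫ w, f w ∂stdGauss κ
      = ∫ q, f (Function.update q.1 k q.2) ∂(stdGauss κ).prod (gaussianReal 0 1) := by
    rw [← integral_map mp.measurable.aemeasurable (by rw [mp.map_eq]; exact hf.aestronglyMeasurable),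
      mp.map_eq]
  rw [c _ h₁, c _ h₂]
  rw [integral_prod _ i₁, integral_prod _ i₂]
  apply integral_congr_ae
  -- Fubini makes the slices in direction `k` integrable only for almost every `w`, which is enough
  -- here.
  filter_upwards [i₀.prod_right_ae, i₁.prod_right_ae, i₂.prod_right_ae] with w j₀ j₁ j₂
  simp only [Function.update_self] at j₀ j₁ j₂ ⊢
  exact integral_id_mul_gaussianReal (fun t => hd w t) j₀ j₁ j₂

/-- Families of functions on `κ → ℝ` that are bounded by an exponential of the `ℓ¹` norm, uniformly
in the parameter. -/
def IsExpBounded (f : ℝ → (κ → ℝ) → ℝ) : Prop :=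
  ∃ C L : ℝ, 0 ≤ C ∧ 0 ≤ L ∧ ∀ θ w, |f θ w| ≤ C * Real.exp (L * ∑ k, |w k|)

namespace IsExpBounded

variable {f g : ℝ → (κ → ℝ) → ℝ}

theorem of_bounded {c : ℝ → ℝ} {K : ℝ} (hc : ∀ θ, |c θ| ≤ K) :
    IsExpBounded (κ := κ) fun θ _ => c θ :=
  ⟨K, 0, (abs_nonneg _).trans (hc 0), le_rfl, fun θ w => by simpa using hc θ⟩

theorem const (c : ℝ) : IsExpBounded (κ := κ) fun _ _ => c := of_bounded fun _ => le_rfl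

theorem coord (k : κ) : IsExpBounded (κ := κ) fun _ w => w k := by
  refine ⟨1, 1, zero_le_one, zero_le_one, fun θ w => ?_⟩
  have h := Finset.single_le_sum (f := fun k => |w k|) (fun i _ => abs_nonneg _)
    (Finset.mem_univ k)
  have := Real.add_one_le_exp (∑ k, |w k|)
  simp only [one_mul]
  linarith

theorem mul (hf : IsExpBounded f) (hg : IsExpBounded g) :
    IsExpBounded fun θ w => f θ w * g θ w := by
  obtain ⟨C, L, hC, hL, h⟩ := hf
  obtain ⟨C', L', hC', hL', h'⟩ := hg
  refine ⟨C * C', L + L', by positivity, by positivity, fun θ w => ?_⟩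
  rw [abs_mul, add_mul, Real.exp_add]
  calc _ ≤ (C * Real.exp (L * ∑ k, |w k|)) * (C' * Real.exp (L' * ∑ k, |w k|)) :=
        mul_le_mul (h θ w) (h' θ w) (abs_nonneg _) (by positivity)
    _ = _ := by ring

theorem add (hf : IsExpBounded f) (hg : IsExpBounded g) :
    IsExpBounded fun θ w => f θ w + g θ w := by
  obtain ⟨C, L, hC, hL, h⟩ := hf
  obtain ⟨C', L', hC', hL', h'⟩ := hg
  refine ⟨C + C', L + L', by positivity, by positivity, fun θ w => ?_⟩
  have hs : 0 ≤ ∑ k, |w k| := Finset.sum_nonneg fun _ _ => abs_nonneg _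
  have e₁ : Real.exp (L * ∑ k, |w k|) ≤ Real.exp ((L + L') * ∑ k, |w k|) :=
    Real.exp_le_exp.2 (by nlinarith)
  have e₂ : Real.exp (L' * ∑ k, |w k|) ≤ Real.exp ((L + L') * ∑ k, |w k|) :=
    Real.exp_le_exp.2 (by nlinarith)
  calc _ ≤ |f θ w| + |g θ w| := abs_add_le _ _
    _ ≤ C * Real.exp (L * ∑ k, |w k|) + C' * Real.exp (L' * ∑ k, |w k|) :=
        add_le_add (h θ w) (h' θ w)
    _ ≤ C * Real.exp ((L + L') * ∑ k, |w k|) + C' * Real.exp ((L + L') * ∑ k, |w k|) := by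
        gcongr
    _ = _ := by ring

theorem sum {ι : Type*} (s : Finset ι) {f : ι → ℝ → (κ → ℝ) → ℝ}
    (hf : ∀ i ∈ s, IsExpBounded (f i)) : IsExpBounded fun θ w => ∑ i ∈ s, f i θ w := by
  classical
  induction s using Finset.induction_on with
  | empty => simpa using const 0
  | insert i s hi ih =>
    simp only [Finset.sum_insert hi]
    exact (hf i (Finset.mem_insert_self i s)).add
      (ih fun j hj => hf j (Finset.mem_insert_of_mem hj))

theorem mono (hf : IsExpBounded f) (h : ∀ θ w, |g θ w| ≤ |f θ w|) : IsExpBounded g := by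
  obtain ⟨C, L, hC, hL, hf⟩ := hf
  exact ⟨C, L, hC, hL, fun θ w => (h θ w).trans (hf θ w)⟩

theorem exp_linear {c : ℝ → κ → ℝ} {K : ℝ} (hc : ∀ θ k, |c θ k| ≤ K) :
    IsExpBounded fun θ w => Real.exp (∑ k, c θ k * w k) := by
  refine ⟨1, |K|, zero_le_one, abs_nonneg _, fun θ w => ?_⟩
  rw [abs_of_pos (Real.exp_pos _), one_mul, Real.exp_le_exp, Finset.mul_sum]
  refine Finset.sum_le_sum fun k _ => (le_abs_self _).trans ?_
  rw [abs_mul]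
  exact mul_le_mul_of_nonneg_right ((hc θ k).trans (le_abs_self K)) (abs_nonneg _)

/-- The bound on the inverse serves negative exponents: differentiating a `p`-th power with `p ≤ 1`
produces the powers `p - 1` and `p - 2`. -/
theorem rpow (hf : IsExpBounded f) (hf' : IsExpBounded fun θ w => (f θ w)⁻¹)
    (hpos : ∀ θ w, 0 < f θ w) (q : ℝ) : IsExpBounded fun θ w => f θ w ^ q := by
  have key {g : ℝ → (κ → ℝ) → ℝ} (hg : IsExpBounded g) (hpos : ∀ θ w, 0 < g θ w) {q : ℝ}
      (hq : 0 ≤ q) : IsExpBounded fun θ w => g θ w ^ q := by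
    obtain ⟨C, L, hC, hL, h⟩ := hg
    refine ⟨C ^ q, L * q, by positivity, by positivity, fun θ w => ?_⟩
    rw [abs_of_pos (Real.rpow_pos_of_pos (hpos θ w) q)]
    calc _ ≤ (C * Real.exp (L * ∑ k, |w k|)) ^ q :=
          Real.rpow_le_rpow (hpos θ w).le ((le_abs_self _).trans (h θ w)) hq
      _ = _ := by
          rw [Real.mul_rpow hC (Real.exp_pos _).le, ← Real.exp_mul]
          congr 2; ring
  rcases le_total 0 q with hq | hq
  · exact key hf hpos hq
  · refine (key hf' (fun θ w => inv_pos.2 (hpos θ w)) (neg_nonneg.2 hq)).mono fun θ w => ?_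
    rw [Real.inv_rpow (hpos θ w).le, Real.rpow_neg (hpos θ w).le, inv_inv]

/-- The majorant does not depend on `θ`, so it also serves for differentiation under the integral
sign. It is integrable because it factors over the coordinates. -/
theorem integrable_dominant (C L : ℝ) :
    Integrable (fun w : κ → ℝ => C * Real.exp (L * ∑ k, |w k|)) (stdGauss κ) := by
  have h₁ : Integrable (fun t : ℝ => Real.exp (L * |t|)) (gaussianReal 0 1) :=
    integrable_exp_mul_abs (integrable_exp_mul_gaussianReal L) (integrable_exp_mul_gaussianReal _)
  have := Integrable.fintype_prod (ι := κ) (f := fun _ (t : ℝ) => Real.exp (L * |t|))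
    (μ := fun _ => gaussianReal 0 1) fun _ => h₁
  refine (this.const_mul C).congr (ae_of_all _ fun w => ?_)
  simp [Finset.mul_sum, Real.exp_sum]

theorem integrable (hf : IsExpBounded f) (θ : ℝ) (hc : Continuous (f θ)) :
    Integrable (f θ) (stdGauss κ) := by
  obtain ⟨C, L, hC, hL, h⟩ := hf
  exact (integrable_dominant C L).mono' hc.aestronglyMeasurable (ae_of_all _ fun w => h θ w)

end IsExpBounded

end GaussianIntegration

/-! ### Slepian-type comparison of Gaussian families by interpolation. -/

section Slepian

variable {κ ι : Type*}

/-- The coefficients of the interpolation `cos θ • a + sin θ • b`. -/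
noncomputable def interp (a b : ι → κ → ℝ) (θ : ℝ) (i : ι) (k : κ) : ℝ :=
  Real.cos θ * a i k + Real.sin θ * b i k

variable (a b : ι → κ → ℝ)

/-- The velocity of the rotation from `a` to `b` is again such a rotation, from `b` to `-a`; all
estimates for `interp` therefore apply to the derivative. -/
theorem hasDerivAt_interp (θ : ℝ) (i : ι) (k : κ) :
    HasDerivAt (fun θ => interp a b θ i k) (interp b (-a) θ i k) θ := by
  have := ((Real.hasDerivAt_cos θ).mul_const (a i k)).add
    ((Real.hasDerivAt_sin θ).mul_const (b i k))
  refine this.congr_deriv ?_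
  simp [interp]
  ring

theorem abs_interp_le (θ : ℝ) (i : ι) (k : κ) : |interp a b θ i k| ≤ |a i k| + |b i k| := by
  refine (abs_add_le _ _).trans ?_
  rw [abs_mul, abs_mul]
  have h₁ := Real.abs_cos_le_one θ
  have h₂ := Real.abs_sin_le_one θ
  nlinarith [abs_nonneg (a i k), abs_nonneg (b i k)]

variable [Fintype κ]

theorem hasDerivAt_exp_interp_update [DecidableEq κ] (θ : ℝ) (w : κ → ℝ) (i : ι) (k : κ) (t : ℝ) :
    HasDerivAt (fun t => Real.exp (∑ l, interp a b θ i l * Function.update w k t l))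
      (Real.exp (∑ l, interp a b θ i l * Function.update w k t l) * interp a b θ i k) t := by
  refine HasDerivAt.exp ?_
  have h (t : ℝ) : ∑ l, interp a b θ i l * Function.update w k t l
      = interp a b θ i k * t + ∑ l ∈ Finset.univ.erase k, interp a b θ i l * w l := by
    rw [← Finset.add_sum_erase _ _ (Finset.mem_univ k)]
    congr 1
    · simp
    · exact Finset.sum_congr rfl fun l hl => by simp [Finset.ne_of_mem_erase hl]
  simp only [h]
  simpa using ((hasDerivAt_id t).const_mul (interp a b θ i k)).add_const
    (∑ l ∈ Finset.univ.erase k, interp a b θ i l * w l)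

theorem hasDerivAt_exp_interp (θ : ℝ) (w : κ → ℝ) (i : ι) :
    HasDerivAt (fun θ => Real.exp (∑ k, interp a b θ i k * w k))
      (Real.exp (∑ k, interp a b θ i k * w k) * ∑ k, interp b (-a) θ i k * w k) θ :=
  (HasDerivAt.fun_sum fun k _ => (hasDerivAt_interp a b θ i k).mul_const (w k)).exp

theorem isExpBounded_interp (i : ι) (k : κ) :
    IsExpBounded (κ := κ) fun θ _ => interp a b θ i k :=
  .of_bounded fun θ => abs_interp_le a b θ i k

theorem isExpBounded_exp_interp (i : ι) :
    IsExpBounded fun θ w => Real.exp (∑ k, interp a b θ i k * w k) :=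
  .exp_linear (K := ∑ k, (|a i k| + |b i k|)) fun θ k => (abs_interp_le a b θ i k).trans
    (Finset.single_le_sum (f := fun k => |a i k| + |b i k|)
      (fun k _ => by positivity) (Finset.mem_univ k))

variable [Fintype ι]

/-- The sum of exponentials `∑ i, exp (c i ⬝ w)` along the interpolation. -/
noncomputable def expSum (θ : ℝ) (w : κ → ℝ) : ℝ :=
  ∑ i, Real.exp (∑ k, interp a b θ i k * w k)

theorem expSum_pos [Nonempty ι] (θ : ℝ) (w : κ → ℝ) : 0 < expSum a b θ w :=
  Finset.sum_pos (fun _ _ => Real.exp_pos _) Finset.univ_nonempty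

theorem exp_le_expSum (θ : ℝ) (w : κ → ℝ) (i : ι) :
    Real.exp (∑ k, interp a b θ i k * w k) ≤ expSum a b θ w :=
  Finset.single_le_sum (f := fun i => Real.exp (∑ k, interp a b θ i k * w k))
    (fun _ _ => (Real.exp_pos _).le) (Finset.mem_univ i)

theorem isExpBounded_expSum_rpow [Nonempty ι] (q : ℝ) :
    IsExpBounded fun θ w => expSum a b θ w ^ q := by
  refine IsExpBounded.rpow ?_ ?_ (expSum_pos a b) q
  · exact IsExpBounded.sum _ fun i _ => isExpBounded_exp_interp a b i
  · obtain ⟨i⟩ := ‹Nonempty ι›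
    -- The sum is at least any single term, so its inverse is at most the exponential of the
    -- opposite linear form.
    refine (isExpBounded_exp_interp (-a) (-b) i).mono fun θ w => ?_
    have : Nonempty ι := ⟨i⟩
    rw [abs_of_pos (inv_pos.2 (expSum_pos a b θ w)), abs_of_pos (Real.exp_pos _)]
    have h := exp_le_expSum a b θ w i
    have e : Real.exp (∑ k, interp (-a) (-b) θ i k * w k)
        = (Real.exp (∑ k, interp a b θ i k * w k))⁻¹ := by
      rw [← Real.exp_neg, ← Finset.sum_neg_distrib]
      congr 2; ext k; simp [interp]; ring
    rw [e]
    exact inv_anti₀ (Real.exp_pos _) h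

@[fun_prop]
theorem continuous_expSum (θ : ℝ) : Continuous (expSum a b θ) := by
  unfold expSum; fun_prop

@[fun_prop]
theorem continuous_expSum_rpow [Nonempty ι] (θ q : ℝ) :
    Continuous fun w => expSum a b θ w ^ q :=
  (continuous_expSum a b θ).rpow_const fun w => Or.inl (expSum_pos a b θ w).ne'

/-- The coefficient of `w k` in the `θ`-derivative of `expSum a b θ w ^ p`. -/
noncomputable def interpGrad (p : ℝ) (θ : ℝ) (k : κ) (w : κ → ℝ) : ℝ :=
  p * (expSum a b θ w ^ (p - 1) *
    ∑ i, interp b (-a) θ i k * Real.exp (∑ l, interp a b θ i l * w l))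

/-- The partial derivative of `interpGrad` with respect to `w k`. -/
noncomputable def interpHess (p : ℝ) (θ : ℝ) (k : κ) (w : κ → ℝ) : ℝ :=
  p * ((p - 1) * expSum a b θ w ^ (p - 1 - 1) *
      (∑ j, Real.exp (∑ l, interp a b θ j l * w l) * interp a b θ j k) *
      (∑ i, interp b (-a) θ i k * Real.exp (∑ l, interp a b θ i l * w l)) +
    expSum a b θ w ^ (p - 1) *
      ∑ i, interp b (-a) θ i k *
        (Real.exp (∑ l, interp a b θ i l * w l) * interp a b θ i k))

/-- The derivative is grouped by the Gaussian coordinates `w k`, the form that integration by parts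
requires. -/
theorem hasDerivAt_expSum_rpow [Nonempty ι] (p θ : ℝ) (w : κ → ℝ) :
    HasDerivAt (fun θ => expSum a b θ w ^ p) (∑ k, w k * interpGrad a b p θ k w) θ := by
  have h : HasDerivAt (fun θ => expSum a b θ w)
      (∑ i, Real.exp (∑ k, interp a b θ i k * w k) * ∑ k, interp b (-a) θ i k * w k) θ :=
    HasDerivAt.fun_sum fun i _ => hasDerivAt_exp_interp a b θ w i
  refine (h.rpow_const (p := p) (Or.inl (expSum_pos a b θ w).ne')).congr_deriv ?_
  simp only [interpGrad, Finset.mul_sum, Finset.sum_mul]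
  rw [Finset.sum_comm]
  refine Finset.sum_congr rfl fun k _ => Finset.sum_congr rfl fun i _ => ?_
  ring

theorem hasDerivAt_interpGrad [Nonempty ι] [DecidableEq κ] (p θ : ℝ) (k : κ) (w : κ → ℝ) (t : ℝ) :
    HasDerivAt (fun t => interpGrad a b p θ k (Function.update w k t))
      (interpHess a b p θ k (Function.update w k t)) t := by
  have h : HasDerivAt (fun t => expSum a b θ (Function.update w k t))
      (∑ j, Real.exp (∑ l, interp a b θ j l * Function.update w k t l) * interp a b θ j k) t :=
    HasDerivAt.fun_sum fun i _ => hasDerivAt_exp_interp_update a b θ w i k t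
  have h₁ := h.rpow_const (p := p - 1) (Or.inl (expSum_pos a b θ (Function.update w k t)).ne')
  have h₂ : HasDerivAt (fun t => ∑ i, interp b (-a) θ i k *
        Real.exp (∑ l, interp a b θ i l * Function.update w k t l))
      (∑ i, interp b (-a) θ i k *
        (Real.exp (∑ l, interp a b θ i l * Function.update w k t l) * interp a b θ i k)) t :=
    HasDerivAt.fun_sum fun i _ => (hasDerivAt_exp_interp_update a b θ w i k t).const_mul _
  refine ((h₁.mul h₂).const_mul p).congr_deriv ?_
  simp only [interpHess]
  ring

theorem isExpBounded_interpGrad [Nonempty ι] (p : ℝ) (k : κ) :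
    IsExpBounded fun θ w => interpGrad a b p θ k w :=
  (IsExpBounded.const p).mul <| (isExpBounded_expSum_rpow a b _).mul <|
    IsExpBounded.sum _ fun i _ => (isExpBounded_interp _ _ i k).mul (isExpBounded_exp_interp a b i)

theorem isExpBounded_interpHess [Nonempty ι] (p : ℝ) (k : κ) :
    IsExpBounded fun θ w => interpHess a b p θ k w :=
  (IsExpBounded.const p).mul <|
    ((((IsExpBounded.const (p - 1)).mul (isExpBounded_expSum_rpow a b _)).mul <|
      IsExpBounded.sum _ fun i _ =>
        (isExpBounded_exp_interp a b i).mul (isExpBounded_interp _ _ i k)).mul <|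
      IsExpBounded.sum _ fun i _ =>
        (isExpBounded_interp _ _ i k).mul (isExpBounded_exp_interp a b i)).add <|
    (isExpBounded_expSum_rpow a b _).mul <|
      IsExpBounded.sum _ fun i _ => (isExpBounded_interp _ _ i k).mul <|
        (isExpBounded_exp_interp a b i).mul (isExpBounded_interp _ _ i k)

theorem continuous_interpGrad [Nonempty ι] (p θ : ℝ) (k : κ) :
    Continuous (interpGrad a b p θ k) := by
  unfold interpGrad; fun_prop

theorem continuous_interpHess [Nonempty ι] (p θ : ℝ) (k : κ) :
    Continuous (interpHess a b p θ k) := by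
  unfold interpHess; fun_prop

/-- Differentiation under the integral gives the terms `w k * interpGrad`; integration by parts
trades each explicit factor `w k` for a partial derivative. -/
theorem hasDerivAt_integral_expSum_rpow [Nonempty ι] (p θ : ℝ) :
    HasDerivAt (fun θ => ∫ w, expSum a b θ w ^ p ∂stdGauss κ)
      (∫ w, ∑ k, interpHess a b p θ k w ∂stdGauss κ) θ := by
  classical
  have hb (k : κ) : IsExpBounded fun θ w => w k * interpGrad a b p θ k w :=
    (IsExpBounded.coord k).mul (isExpBounded_interpGrad a b p k)
  have hc (k : κ) (θ : ℝ) : Continuous fun w : κ → ℝ => w k * interpGrad a b p θ k w :=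
    (continuous_apply k).mul (continuous_interpGrad a b p θ k)
  obtain ⟨C, L, hC, hL, hbd⟩ := IsExpBounded.sum Finset.univ fun k _ => hb k
  have main := (hasDerivAt_integral_of_dominated_loc_of_deriv_le (μ := stdGauss κ)
    (F := fun θ w => expSum a b θ w ^ p) (F' := fun θ w => ∑ k, w k * interpGrad a b p θ k w)
    (x₀ := θ) (s := Set.univ) Filter.univ_mem
    (Filter.Eventually.of_forall fun θ => (continuous_expSum_rpow a b θ p).aestronglyMeasurable)
    ((isExpBounded_expSum_rpow a b p).integrable θ (continuous_expSum_rpow a b θ p))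
    (continuous_finsetSum _ fun k _ => hc k θ).aestronglyMeasurable
    (ae_of_all _ fun w θ _ => hbd θ w) (IsExpBounded.integrable_dominant C L)
    (ae_of_all _ fun w θ _ => hasDerivAt_expSum_rpow a b p θ w)).2
  refine main.congr_deriv ?_
  rw [integral_finsetSum _ fun k _ => (hb k).integrable θ (hc k θ),
    integral_finsetSum _ fun k _ => (isExpBounded_interpHess a b p k).integrable θ
      (continuous_interpHess a b p θ k)]
  refine Finset.sum_congr rfl fun k _ => ?_
  exact integral_coord_mul_stdGauss k (fun w t => hasDerivAt_interpGrad a b p θ k w t)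
    ((isExpBounded_interpGrad a b p k).integrable θ (continuous_interpGrad a b p θ k))
    ((hb k).integrable θ (hc k θ))
    ((isExpBounded_interpHess a b p k).integrable θ (continuous_interpHess a b p θ k))

variable {a b}

/-- Only the covariances between velocity and position enter. They vanish for `i = j` by equality of
variances, which kills the term in `expSum ^ (p - 1)`. In the remaining term the factor `p - 1` and
the covariances are both nonpositive. -/
theorem sum_interpHess_nonneg [Nonempty ι] {p θ : ℝ} (hp₀ : 0 ≤ p) (hp₁ : p ≤ 1)
    (hcross : ∀ i j, ∑ k, a i k * b j k = 0) (hvar : ∀ i, ∑ k, b i k ^ 2 = ∑ k, a i k ^ 2)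
    (hcov : ∀ i j, ∑ k, b i k * b j k ≤ ∑ k, a i k * a j k)
    (hθ : 0 ≤ Real.sin θ * Real.cos θ) (w : κ → ℝ) :
    0 ≤ ∑ k, interpHess a b p θ k w := by
  have hQ (i j : ι) : ∑ k, interp b (-a) θ i k * interp a b θ j k
      = Real.sin θ * Real.cos θ * (∑ k, b i k * b j k - ∑ k, a i k * a j k) := by
    have h₁ := hcross i j
    have h₂ := hcross j i
    calc _ = Real.sin θ * Real.cos θ * (∑ k, b i k * b j k - ∑ k, a i k * a j k)
          + Real.cos θ ^ 2 * ∑ k, a j k * b i k - Real.sin θ ^ 2 * ∑ k, a i k * b j k := by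
          simp only [mul_sub, Finset.mul_sum, ← Finset.sum_sub_distrib, ← Finset.sum_add_distrib]
          refine Finset.sum_congr rfl fun k _ => ?_
          simp only [interp, Pi.neg_apply]
          ring
      _ = _ := by rw [h₁, h₂]; ring
  have hd (i : ι) : ∑ k, interp b (-a) θ i k * interp a b θ i k = 0 := by
    rw [hQ]; simp only [← pow_two, hvar, sub_self, mul_zero]
  set e : ι → ℝ := fun i => Real.exp (∑ l, interp a b θ i l * w l) with he
  -- Summing over `k` first turns the products of coefficients into the covariances computed in
  -- `hQ`.
  have hrw : ∑ k, interpHess a b p θ k w = p * ((p - 1) * expSum a b θ w ^ (p - 1 - 1) *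
      (∑ i, ∑ j, e i * e j * ∑ k, interp b (-a) θ i k * interp a b θ j k)
      + expSum a b θ w ^ (p - 1) * ∑ i, e i * ∑ k, interp b (-a) θ i k * interp a b θ i k) := by
    simp only [interpHess, ← Finset.mul_sum, Finset.sum_add_distrib]
    congr 2
    · simp only [mul_assoc, ← Finset.mul_sum]
      congr 2
      simp only [Finset.sum_mul_sum]
      simp only [Finset.mul_sum]
      rw [Finset.sum_comm]
      conv_rhs => rw [Finset.sum_comm]
      refine Finset.sum_congr rfl fun j _ => ?_
      rw [Finset.sum_comm]
      refine Finset.sum_congr rfl fun i _ => Finset.sum_congr rfl fun k _ => ?_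
      ring
    · congr 1
      simp only [Finset.mul_sum]
      rw [Finset.sum_comm]
      refine Finset.sum_congr rfl fun i _ => Finset.sum_congr rfl fun k _ => ?_
      ring
  rw [hrw]
  simp only [hd, mul_zero, Finset.sum_const_zero, add_zero]
  refine mul_nonneg hp₀ (mul_nonneg_of_nonpos_of_nonpos ?_ ?_)
  · exact mul_nonpos_of_nonpos_of_nonneg (by linarith)
      (Real.rpow_nonneg (expSum_pos a b θ w).le _)
  · refine Finset.sum_nonpos fun i _ => Finset.sum_nonpos fun j _ => ?_
    refine mul_nonpos_of_nonneg_of_nonpos (mul_pos (Real.exp_pos _) (Real.exp_pos _)).le ?_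
    rw [hQ]
    exact mul_nonpos_of_nonneg_of_nonpos hθ (sub_nonpos.2 (hcov i j))

/-- Gaussian comparison: if two centred Gaussian families have the same variances and the
covariances of the first dominate those of the second, then `(∑ i, exp (X i)) ^ p` has smaller
expectation for the first, for every `p` between `0` and `1`. -/
theorem integral_sum_exp_rpow_le [Nonempty ι] {p : ℝ} (hp₀ : 0 ≤ p) (hp₁ : p ≤ 1)
    (hcross : ∀ i j, ∑ k, a i k * b j k = 0) (hvar : ∀ i, ∑ k, b i k ^ 2 = ∑ k, a i k ^ 2)
    (hcov : ∀ i j, ∑ k, b i k * b j k ≤ ∑ k, a i k * a j k) :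
    ∫ w, (∑ i, Real.exp (∑ k, a i k * w k)) ^ p ∂stdGauss κ
      ≤ ∫ w, (∑ i, Real.exp (∑ k, b i k * w k)) ^ p ∂stdGauss κ := by
  have hd := hasDerivAt_integral_expSum_rpow a b p
  have hm : MonotoneOn (fun θ => ∫ w, expSum a b θ w ^ p ∂stdGauss κ)
      (Set.Icc 0 (Real.pi / 2)) := by
    refine monotoneOn_of_deriv_nonneg (convex_Icc _ _)
      (fun θ _ => (hd θ).continuousAt.continuousWithinAt)
      (fun θ _ => (hd θ).differentiableAt.differentiableWithinAt) fun θ hθ => ?_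
    rw [interior_Icc] at hθ
    rw [(hd θ).deriv]
    refine integral_nonneg fun w => sum_interpHess_nonneg hp₀ hp₁ hcross hvar hcov ?_ w
    exact mul_nonneg (Real.sin_nonneg_of_nonneg_of_le_pi hθ.1.le (by linarith [hθ.2, Real.pi_pos]))
      (Real.cos_nonneg_of_neg_pi_div_two_le_of_le (by linarith [hθ.1, Real.pi_pos]) hθ.2.le)
  have := hm (Set.left_mem_Icc.2 (by positivity)) (Set.right_mem_Icc.2 (by positivity))
    (by positivity)
  simpa [expSum, interp] using this

end Slepian

/-! ### Tail bound for the operator norm of a Gaussian matrix. -/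

section GaussianMatrix

theorem integrable_exp_mul_sq_gaussianReal {c : ℝ} (hc : c < 1 / 2) :
    Integrable (fun x => Real.exp (c * x ^ 2)) (gaussianReal 0 1) := by
  rw [integrable_gaussianReal_iff]
  have h := (integrable_exp_neg_mul_sq (b := 1 / 2 - c) (by linarith)).const_mul
    (√(2 * Real.pi))⁻¹
  refine h.congr (ae_of_all _ fun x => ?_)
  simp only [gaussianPDFReal, NNReal.coe_one, mul_one, sub_zero, mul_assoc, ← Real.exp_add]
  congr 2; ring

theorem integral_exp_mul_sq_gaussianReal {c : ℝ} (hc : c < 1 / 2) :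
    ∫ x, Real.exp (c * x ^ 2) ∂gaussianReal 0 1 = (√(1 - 2 * c))⁻¹ := by
  rw [integral_gaussianReal_eq_integral_smul one_ne_zero]
  have h (x : ℝ) : gaussianPDFReal 0 1 x • Real.exp (c * x ^ 2)
      = (√(2 * Real.pi))⁻¹ * Real.exp (-(1 / 2 - c) * x ^ 2) := by
    simp only [gaussianPDFReal, NNReal.coe_one, mul_one, sub_zero, smul_eq_mul, mul_assoc,
      ← Real.exp_add]
    congr 2; ring
  simp only [h]
  rw [integral_const_mul, integral_gaussian, ← Real.sqrt_inv, ← Real.sqrt_mul (by positivity),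
    ← Real.sqrt_inv]
  congr 1
  have : 1 - 2 * c ≠ 0 := by linarith
  have : 1 / 2 - c ≠ 0 := by intro h; apply this; linarith
  field_simp

theorem integral_exp_mul_gaussianReal (t : ℝ) :
    ∫ x, Real.exp (t * x) ∂gaussianReal 0 1 = Real.exp (t ^ 2 / 2) := by
  have := congrFun (mgf_id_gaussianReal (μ := 0) (v := 1)) t
  simpa [mgf] using this

/-- The moment generating function of the Euclidean norm of a standard Gaussian vector in
dimension `m` is at most `exp (t √m + t² / 2)`; this is the bound for the quadratic upper
estimate `|g| ≤ (A + |g|² / A) / 2` with `A = t + √m`. -/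
theorem exp_mul_integral_exp_sq_pow_le {m : ℕ} (hm : 0 < m) {t : ℝ} (ht : 0 < t) :
    Real.exp (t * (t + √m) / 2) *
        (∫ x, Real.exp (t / (2 * (t + √m)) * x ^ 2) ∂gaussianReal 0 1) ^ m
      ≤ Real.exp (t * √m + t ^ 2 / 2) := by
  have hs : 0 < √(m : ℝ) := Real.sqrt_pos.2 (by exact_mod_cast hm)
  have hA : 0 < t + √(m : ℝ) := by positivity
  have hc : t / (2 * (t + √(m : ℝ))) < 1 / 2 := by
    rw [div_lt_div_iff₀ (by positivity) (by norm_num)]; linarith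
  rw [integral_exp_mul_sq_gaussianReal hc]
  -- With `A = t + √m` the Gaussian integral becomes the square root of `1 + t / √m`, and `1 + x ≤
  -- exp x` bounds it with exactly the needed exponent.
  have h₁ : 1 - 2 * (t / (2 * (t + √(m : ℝ)))) = (1 + t / √m)⁻¹ := by
    field_simp; ring
  have h₂ : (√(1 - 2 * (t / (2 * (t + √(m : ℝ))))))⁻¹ ≤ Real.exp (t / √m / 2) := by
    rw [h₁, Real.sqrt_inv, inv_inv, Real.exp_half]
    exact Real.sqrt_le_sqrt (by linarith [Real.add_one_le_exp (t / √(m : ℝ))])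
  calc _ ≤ Real.exp (t * (t + √m) / 2) * Real.exp (t / √m / 2) ^ m := by gcongr
    _ = _ := by
      rw [← Real.exp_nat_mul, ← Real.exp_add]
      congr 1
      have : (m : ℝ) = √m * √m := (Real.mul_self_sqrt (by positivity)).symm
      have h : (m : ℝ) * (t / √m / 2) = t * √m / 2 := by
        nth_rewrite 1 [this]; field_simp
      rw [h]; ring

variable {α β ι : Type*} [Fintype α] [Fintype β]

/-- Coefficients of the family `⟨G v, u⟩ + γ`, multiplied by `s`: `G` is a Gaussian matrix and `γ` an
independent Gaussian variable. -/
def bilinearCoeff (s : ℝ) (u : ι → α → ℝ) (v : ι → β → ℝ) (i : ι) :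
    (α × β) ⊕ (Unit ⊕ (α ⊕ β)) → ℝ :=
  Sum.elim (fun q => s * (u i q.1 * v i q.2)) (Sum.elim (fun _ => s) fun _ => 0)

/-- Coefficients of the family `⟨g, u⟩ + ⟨h, v⟩`, multiplied by `s`: `g` and `h` are independent
Gaussian vectors. -/
def linearCoeff (s : ℝ) (u : ι → α → ℝ) (v : ι → β → ℝ) (i : ι) :
    (α × β) ⊕ (Unit ⊕ (α ⊕ β)) → ℝ :=
  Sum.elim (fun _ => 0) (Sum.elim (fun _ => 0) (Sum.elim (fun x => s * u i x) fun y => s * v i y))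

theorem sum_mul_le_one {m : Type*} [Fintype m] {u v : m → ℝ} (hu : ∑ x, u x ^ 2 = 1)
    (hv : ∑ x, v x ^ 2 = 1) : ∑ x, u x * v x ≤ 1 := by
  have h : ∑ x, u x * v x ≤ ∑ x, (u x ^ 2 / 2 + v x ^ 2 / 2) :=
    Finset.sum_le_sum fun x _ => by nlinarith [sq_nonneg (u x - v x)]
  rw [Finset.sum_add_distrib, ← Finset.sum_div, ← Finset.sum_div, hu, hv] at h
  linarith

theorem sum_prod_mul (u u' : α → ℝ) (v v' : β → ℝ) (s : ℝ) :
    ∑ q : α × β, s * (u q.1 * v q.2) * (s * (u' q.1 * v' q.2))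
      = s ^ 2 * ((∑ x, u x * u' x) * ∑ y, v y * v' y) := by
  rw [Fintype.sum_prod_type, Finset.sum_mul_sum, Finset.mul_sum]
  refine Finset.sum_congr rfl fun x _ => ?_
  rw [Finset.mul_sum]
  exact Finset.sum_congr rfl fun y _ => by ring

/-- Both families live on one Gaussian space and use disjoint coordinates, hence are independent.
The extra variable `γ` equalizes the variances. With `x`, `y` the inner products of the unit
vectors, the covariances compare through `x + y ≤ x * y + 1`, that is `(1 - x) * (1 - y) ≥ 0`. -/
theorem integral_bilinear_le_integral_linear [Fintype ι] [Nonempty ι] {p : ℝ} (hp₀ : 0 ≤ p)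
    (hp₁ : p ≤ 1) (s : ℝ)
    {u : ι → α → ℝ} {v : ι → β → ℝ} (hu : ∀ i, ∑ x, u i x ^ 2 = 1) (hv : ∀ i, ∑ y, v i y ^ 2 = 1) :
    ∫ w, (∑ i, Real.exp (∑ k, bilinearCoeff s u v i k * w k)) ^ p ∂stdGauss _
      ≤ ∫ w, (∑ i, Real.exp (∑ k, linearCoeff s u v i k * w k)) ^ p ∂stdGauss _ := by
  have hb (i j : ι) : ∑ k, bilinearCoeff s u v i k * bilinearCoeff s u v j k
      = s ^ 2 * ((∑ x, u i x * u j x) * (∑ y, v i y * v j y) + 1) := by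
    simp only [Fintype.sum_sum_type, bilinearCoeff, Sum.elim_inl, Sum.elim_inr, sum_prod_mul]
    simp; ring
  have hl (i j : ι) : ∑ k, linearCoeff s u v i k * linearCoeff s u v j k
      = s ^ 2 * ((∑ x, u i x * u j x) + (∑ y, v i y * v j y)) := by
    simp only [Fintype.sum_sum_type, linearCoeff, Sum.elim_inl, Sum.elim_inr]
    simp only [mul_zero, Finset.sum_const_zero, zero_add, mul_add, Finset.mul_sum]
    congr 1 <;> exact Finset.sum_congr rfl fun _ _ => by ring
  refine integral_sum_exp_rpow_le hp₀ hp₁ (fun i j => ?_) (fun i => ?_) (fun i j => ?_)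
  · simp [bilinearCoeff, linearCoeff]
  · simp only [pow_two] at hu hv
    simp only [pow_two (linearCoeff _ _ _ _ _), pow_two (bilinearCoeff _ _ _ _ _), hb, hl, hu, hv]
    ring
  · rw [hb, hl]
    refine mul_le_mul_of_nonneg_left ?_ (sq_nonneg s)
    nlinarith [sum_mul_le_one (hu i) (hu j), sum_mul_le_one (hv i) (hv j)]

/-- The integrable majorant of the comparison family: a product over the coordinates. -/
noncomputable def quadFactor (c₁ c₂ : ℝ) : (α × β) ⊕ (Unit ⊕ (α ⊕ β)) → ℝ → ℝ :=
  Sum.elim (fun _ _ => 1) (Sum.elim (fun _ _ => 1)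
    (Sum.elim (fun _ t => Real.exp (c₁ * t ^ 2)) fun _ t => Real.exp (c₂ * t ^ 2)))

/-- A quadratic bound replaces the norm of `g` because its exponential factors over the coordinates;
it is uniform in the unit vector `u`. -/
theorem sum_mul_le_quadratic {m : Type*} [Fintype m] {u : m → ℝ} (hu : ∑ x, u x ^ 2 = 1)
    (g : m → ℝ) {A : ℝ} (hA : 0 < A) : ∑ x, u x * g x ≤ A / 2 + ∑ x, g x ^ 2 / (2 * A) := by
  calc ∑ x, u x * g x ≤ ∑ x, (A / 2 * u x ^ 2 + g x ^ 2 / (2 * A)) := by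
        refine Finset.sum_le_sum fun x _ => ?_
        have : A / 2 * u x ^ 2 + g x ^ 2 / (2 * A) - u x * g x = (A * u x - g x) ^ 2 / (2 * A) := by
          field_simp; ring
        have h : 0 ≤ (A * u x - g x) ^ 2 / (2 * A) := by positivity
        linarith
    _ = _ := by rw [Finset.sum_add_distrib, ← Finset.mul_sum, hu, mul_one]

/-- Every exponent is at most `t / p * Z` with `Z` independent of `i`, so the `p`-th power of the
sum is at most `card ι ^ p * exp (t * Z)`, whose integral is a product of one-dimensional ones. -/
theorem integral_linear_le [Nonempty α] [Nonempty β] [Fintype ι] {p t : ℝ} (hp₀ : 0 < p)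
    (ht : 0 < t) {u : ι → α → ℝ} {v : ι → β → ℝ}
    (hu : ∀ i, ∑ x, u i x ^ 2 = 1) (hv : ∀ i, ∑ y, v i y ^ 2 = 1) :
    ∫ w, (∑ i, Real.exp (∑ k, linearCoeff (t / p) u v i k * w k)) ^ p ∂stdGauss _
      ≤ (Fintype.card ι : ℝ) ^ p *
        Real.exp (t * (√(Fintype.card α) + √(Fintype.card β)) + t ^ 2) := by
  set A : ℝ := t + √(Fintype.card α) with hA
  set B : ℝ := t + √(Fintype.card β) with hB
  have hα : 0 < √(Fintype.card α : ℝ) := Real.sqrt_pos.2 (by exact_mod_cast Fintype.card_pos)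
  have hβ : 0 < √(Fintype.card β : ℝ) := Real.sqrt_pos.2 (by exact_mod_cast Fintype.card_pos)
  have hA₀ : 0 < A := by positivity
  have hB₀ : 0 < B := by positivity
  have hcA : t / (2 * A) < 1 / 2 := by
    rw [div_lt_div_iff₀ (by positivity) (by norm_num)]; linarith
  have hcB : t / (2 * B) < 1 / 2 := by
    rw [div_lt_div_iff₀ (by positivity) (by norm_num)]; linarith
  have hint : Integrable (fun w : (α × β) ⊕ (Unit ⊕ (α ⊕ β)) → ℝ =>
      (Fintype.card ι : ℝ) ^ p * Real.exp (t * (A + B) / 2) *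
        ∏ k, quadFactor (t / (2 * A)) (t / (2 * B)) k (w k)) (stdGauss _) := by
    refine (Integrable.fintype_prod fun k => ?_).const_mul _
    rcases k with q | _ | x | y
    · exact integrable_const 1
    · exact integrable_const 1
    · exact integrable_exp_mul_sq_gaussianReal hcA
    · exact integrable_exp_mul_sq_gaussianReal hcB
  have hle (w : (α × β) ⊕ (Unit ⊕ (α ⊕ β)) → ℝ) :
      (∑ i, Real.exp (∑ k, linearCoeff (t / p) u v i k * w k)) ^ p
        ≤ (Fintype.card ι : ℝ) ^ p * Real.exp (t * (A + B) / 2) *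
        ∏ k, quadFactor (t / (2 * A)) (t / (2 * B)) k (w k) := by
    set Z : ℝ := (A + B) / 2 + ∑ x, w (.inr (.inr (.inl x))) ^ 2 / (2 * A)
      + ∑ y, w (.inr (.inr (.inr y))) ^ 2 / (2 * B) with hZ
    have h₁ (i : ι) : ∑ k, linearCoeff (t / p) u v i k * w k ≤ t / p * Z := by
      simp only [Fintype.sum_sum_type, linearCoeff, Sum.elim_inl, Sum.elim_inr]
      simp only [zero_mul, Finset.sum_const_zero, zero_add, mul_assoc, ← Finset.mul_sum, ← mul_add]
      refine mul_le_mul_of_nonneg_left ?_ (by positivity)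
      have := sum_mul_le_quadratic (hu i) (fun x => w (.inr (.inr (.inl x)))) hA₀
      have := sum_mul_le_quadratic (hv i) (fun y => w (.inr (.inr (.inr y)))) hB₀
      linarith
    calc _ ≤ (∑ _i : ι, Real.exp (t / p * Z)) ^ p :=
          Real.rpow_le_rpow (Finset.sum_nonneg fun _ _ => (Real.exp_pos _).le)
            (Finset.sum_le_sum fun i _ => Real.exp_le_exp.2 (h₁ i)) hp₀.le
      _ = (Fintype.card ι : ℝ) ^ p * Real.exp (t * Z) := by
          rw [Finset.sum_const, Finset.card_univ, nsmul_eq_mul,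
            Real.mul_rpow (by positivity) (Real.exp_pos _).le, ← Real.exp_mul]
          congr 2; field_simp
      _ = _ := by
          rw [mul_assoc]
          congr 1
          simp only [Fintype.prod_sum_type, quadFactor, Sum.elim_inl, Sum.elim_inr,
            Finset.prod_const_one, one_mul, ← Real.exp_sum, ← Real.exp_add]
          congr 1
          rw [hZ, mul_add, mul_add, Finset.mul_sum, Finset.mul_sum, add_assoc]
          congr 1
          · ring
          · congr 1 <;> exact Finset.sum_congr rfl fun _ _ => by ring
  calc _ ≤ ∫ w, (Fintype.card ι : ℝ) ^ p * Real.exp (t * (A + B) / 2) *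
        ∏ k, quadFactor (t / (2 * A)) (t / (2 * B)) k (w k)
          ∂stdGauss ((α × β) ⊕ (Unit ⊕ (α ⊕ β))) :=
        integral_mono_of_nonneg (ae_of_all _ fun w => Real.rpow_nonneg
          (Finset.sum_nonneg fun _ _ => (Real.exp_pos _).le) _) hint (ae_of_all _ hle)
    _ = (Fintype.card ι : ℝ) ^ p *
          ((Real.exp (t * A / 2) *
            (∫ x, Real.exp (t / (2 * A) * x ^ 2) ∂gaussianReal 0 1) ^ Fintype.card α) *
          (Real.exp (t * B / 2) *
            (∫ x, Real.exp (t / (2 * B) * x ^ 2) ∂gaussianReal 0 1) ^ Fintype.card β)) := by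
        rw [integral_const_mul, integral_fintype_prod_eq_prod]
        simp only [Fintype.prod_sum_type, quadFactor, Sum.elim_inl, Sum.elim_inr, Finset.prod_const,
          Finset.card_univ, integral_const, probReal_univ, smul_eq_mul, mul_one, one_pow, one_mul]
        rw [show t * (A + B) / 2 = t * A / 2 + t * B / 2 by ring, Real.exp_add]
        ring
    _ ≤ (Fintype.card ι : ℝ) ^ p * (Real.exp (t * √(Fintype.card α) + t ^ 2 / 2) *
          Real.exp (t * √(Fintype.card β) + t ^ 2 / 2)) := by
        have h₁ := exp_mul_integral_exp_sq_pow_le (m := Fintype.card α) Fintype.card_pos ht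
        have h₂ := exp_mul_integral_exp_sq_pow_le (m := Fintype.card β) Fintype.card_pos ht
        refine mul_le_mul_of_nonneg_left (mul_le_mul h₁ h₂ ?_ (Real.exp_pos _).le) (by positivity)
        have : 0 ≤ ∫ x, Real.exp (t / (2 * B) * x ^ 2) ∂gaussianReal 0 1 :=
          integral_nonneg fun _ => (Real.exp_pos _).le
        positivity
    _ = _ := by rw [← Real.exp_add]; congr 2; ring

/-- The event that the bilinear form of the matrix `w` exceeds `s` at one of the pairs of a
family. -/
def exceedSet (u : ι → α → ℝ) (v : ι → β → ℝ) (s : ℝ) : Set (α × β → ℝ) :=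
  {w | ∃ i, s < ∑ q : α × β, u i q.1 * v i q.2 * w q}

theorem measurableSet_exceedSet [Countable ι] (u : ι → α → ℝ) (v : ι → β → ℝ) (s : ℝ) :
    MeasurableSet (exceedSet u v s) := by
  simp only [exceedSet, Set.ofPred_exists]
  exact MeasurableSet.iUnion fun i => measurableSet_lt measurable_const (by fun_prop)

/-- A Chernoff bound: on the event, one term alone makes the power at least `exp (t * (s + γ))`.
Since `γ` is independent of the matrix, it contributes the factor `exp (t ^ 2 / 2)`. -/
theorem le_integral_bilinear [Fintype ι] [Nonempty ι] {p t : ℝ} (hp₀ : 0 < p) (ht : 0 < t) (s : ℝ)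
    (u : ι → α → ℝ) (v : ι → β → ℝ) :
    (stdGauss (α × β)).real (exceedSet u v s) * Real.exp (t * s + t ^ 2 / 2)
      ≤ ∫ w, (∑ i, Real.exp (∑ k, bilinearCoeff (t / p) u v i k * w k)) ^ p ∂stdGauss _ := by
  have hms := measurableSet_exceedSet u v s
  have mp := measurePreserving_sumPiEquivProdPi (ι := α × β) (ι' := Unit ⊕ (α ⊕ β))
    (X := fun _ => ℝ) fun _ => gaussianReal 0 1
  set f : (α × β → ℝ) → ℝ := (exceedSet u v s).indicator fun _ => Real.exp (t * s) with hf
  set g : (Unit ⊕ (α ⊕ β) → ℝ) → ℝ := fun y => Real.exp (t * y (.inl ())) with hg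
  have hgi : ∫ y, g y ∂stdGauss (Unit ⊕ (α ⊕ β)) = Real.exp (t ^ 2 / 2) := by
    have := integral_fintype_prod_eq_prod (μ := fun _ : Unit ⊕ (α ⊕ β) => gaussianReal 0 1)
      (Sum.elim (fun _ x => Real.exp (t * x)) fun _ _ => (1 : ℝ))
    simpa [Fintype.prod_sum_type, integral_exp_mul_gaussianReal] using this
  have hfi : ∫ y, f y ∂stdGauss (α × β)
      = (stdGauss (α × β)).real (exceedSet u v s) * Real.exp (t * s) := by
    rw [hf, integral_indicator_const _ hms, smul_eq_mul]
  have hprod : ∫ w, f (fun q => w (.inl q)) * g (fun k => w (.inr k))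
      ∂stdGauss ((α × β) ⊕ (Unit ⊕ (α ⊕ β)))
      = (stdGauss (α × β)).real (exceedSet u v s) * Real.exp (t * s + t ^ 2 / 2) := by
    have h := mp.integral_comp' (g := fun z => f z.1 * g z.2)
    rw [integral_prod_mul, hfi, hgi, mul_assoc, ← Real.exp_add] at h
    exact h
  rw [← hprod]
  refine integral_mono_of_nonneg (ae_of_all _ fun w => ?_) ?_ (ae_of_all _ fun w => ?_)
  · exact mul_nonneg (Set.indicator_nonneg (fun _ _ => (Real.exp_pos _).le) _) (Real.exp_pos _).le
  · have h₁ := (isExpBounded_expSum_rpow (bilinearCoeff (t / p) u v) 0 p).integrable 0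
      (continuous_expSum_rpow _ _ 0 p)
    simpa [expSum, interp] using h₁
  · by_cases hw : (fun q => w (.inl q)) ∈ exceedSet u v s
    · simp only [hf, hg, Set.indicator_of_mem hw]
      obtain ⟨i, hi⟩ := hw
      rw [← Real.exp_add, ← mul_add]
      have h₁ : ∑ k, bilinearCoeff (t / p) u v i k * w k
          = t / p * (∑ q : α × β, u i q.1 * v i q.2 * w (.inl q) + w (.inr (.inl ()))) := by
        simp [Fintype.sum_sum_type, bilinearCoeff, mul_add, Finset.mul_sum, mul_assoc]
      calc Real.exp (t * (s + w (.inr (.inl ()))))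
          = Real.exp (t / p * (s + w (.inr (.inl ())))) ^ p := by
            rw [← Real.exp_mul]; congr 1; field_simp
        _ ≤ Real.exp (∑ k, bilinearCoeff (t / p) u v i k * w k) ^ p := by
            refine Real.rpow_le_rpow (Real.exp_pos _).le (Real.exp_le_exp.2 ?_) hp₀.le
            rw [h₁]
            exact mul_le_mul_of_nonneg_left (by linarith) (by positivity)
        _ ≤ _ := Real.rpow_le_rpow (Real.exp_pos _).le
            (Finset.single_le_sum
              (f := fun i => Real.exp (∑ k, bilinearCoeff (t / p) u v i k * w k))
              (fun _ _ => (Real.exp_pos _).le) (Finset.mem_univ i)) hp₀.le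
    · simp only [hf, Set.indicator_of_notMem hw, zero_mul]
      exact Real.rpow_nonneg (Finset.sum_nonneg fun _ _ => (Real.exp_pos _).le) _

theorem measureReal_exceedSet_le [Nonempty α] [Nonempty β] [Fintype ι] {t : ℝ} (ht : 0 < t)
    {u : ι → α → ℝ} {v : ι → β → ℝ}
    (hu : ∀ i, ∑ x, u i x ^ 2 = 1) (hv : ∀ i, ∑ y, v i y ^ 2 = 1) :
    (stdGauss (α × β)).real (exceedSet u v (√(Fintype.card α) + √(Fintype.card β) + t))
      ≤ Real.exp (-(t ^ 2 / 2)) := by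
  rcases isEmpty_or_nonempty ι with hι | hι
  · have : exceedSet u v (√(Fintype.card α) + √(Fintype.card β) + t) = ∅ := by
      ext w; simp [exceedSet]
    rw [this]; simp; positivity
  set S : ℝ := √(Fintype.card α) + √(Fintype.card β) with hS
  -- At the level `S + t` the exponents are `t * S + t ^ 2` above and `t * (S + t) + t ^ 2 / 2`
  -- below; their difference is `-(t ^ 2 / 2)`.
  have key (p : ℝ) (hp : p ∈ Set.Ioc (0 : ℝ) 1) :
      (stdGauss (α × β)).real (exceedSet u v (S + t))
        ≤ (Fintype.card ι : ℝ) ^ p * Real.exp (-(t ^ 2 / 2)) := by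
    have h := (le_integral_bilinear hp.1 ht (S + t) u v).trans
      ((integral_bilinear_le_integral_linear hp.1.le hp.2 (t / p) hu hv).trans
        (integral_linear_le hp.1 ht hu hv))
    rw [← le_div_iff₀ (Real.exp_pos _), mul_div_assoc, ← Real.exp_sub] at h
    rwa [show t * (√(Fintype.card α) + √(Fintype.card β)) + t ^ 2 - (t * (S + t) + t ^ 2 / 2)
      = -(t ^ 2 / 2) by rw [hS]; ring] at h
  -- As `p → 0` the cardinality of the family drops out.
  have hlim : Filter.Tendsto (fun p : ℝ => (Fintype.card ι : ℝ) ^ p * Real.exp (-(t ^ 2 / 2)))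
      (nhdsWithin 0 (Set.Ioi 0)) (nhds (Real.exp (-(t ^ 2 / 2)))) := by
    have hc : ContinuousAt (fun p : ℝ => (Fintype.card ι : ℝ) ^ p) 0 :=
      Real.continuousAt_const_rpow (by exact_mod_cast Fintype.card_ne_zero)
    have := (hc.tendsto.mono_left nhdsWithin_le_nhds).mul_const (Real.exp (-(t ^ 2 / 2)))
      (f := fun p : ℝ => (Fintype.card ι : ℝ) ^ p) (x := nhdsWithin 0 (Set.Ioi 0))
    simpa using this
  refine ge_of_tendsto hlim ?_
  filter_upwards [Ioc_mem_nhdsGT (zero_lt_one' ℝ)] with p hp using key p hp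

/-- **Norm of a Gaussian matrix**: with probability at least `1 - exp (-t² / 2)`, an `α × β`
matrix of independent standard Gaussian entries has operator norm at most
`√(card α) + √(card β) + t`. -/
theorem measureReal_norm_gaussianMatrix_le [Nonempty α] [Nonempty β] [DecidableEq β] {t : ℝ}
    (ht : 0 < t) :
    (stdGauss (α × β)).real {w | ¬ ∀ x : EuclideanSpace ℝ β,
        ‖Matrix.toEuclideanLin (Matrix.of fun a b => w (a, b)) x‖
          ≤ (√(Fintype.card α) + √(Fintype.card β) + t) * ‖x‖}
      ≤ Real.exp (-(t ^ 2 / 2)) := by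
  set S : ℝ := √(Fintype.card α) + √(Fintype.card β) + t with hS
  have hS₀ : 0 < S := by positivity
  set U := {q : (α → ℝ) × (β → ℝ) // ∑ x, q.1 x ^ 2 = 1 ∧ ∑ y, q.2 y ^ 2 = 1}
  set E := {w : α × β → ℝ | ¬ ∀ x : EuclideanSpace ℝ β,
        ‖Matrix.toEuclideanLin (Matrix.of fun a b => w (a, b)) x‖ ≤ S * ‖x‖} with hE
  have hsub : E ⊆ exceedSet (fun q : U => q.1.1) (fun q : U => q.1.2) S := by
    intro w hw
    simp only [hE, Set.mem_ofPred_eq, not_forall, not_le] at hw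
    obtain ⟨x, hx⟩ := hw
    set M := Matrix.toEuclideanLin (Matrix.of fun a b => w (a, b)) with hM
    have hx₀ : 0 < ‖x‖ := by
      rw [norm_pos_iff]; rintro rfl; simp at hx
    have hy₀ : 0 < ‖M x‖ := lt_of_le_of_lt (by positivity) hx
    -- The normalized `M x` and `x` form the pair of unit vectors at which the bilinear form equals
    -- `‖M x‖ / ‖x‖`.
    refine ⟨⟨(fun a => ‖M x‖⁻¹ * M x a, fun b => ‖x‖⁻¹ * x b), ?_, ?_⟩, ?_⟩
    · simp only [mul_pow, ← Finset.mul_sum, ← EuclideanSpace.real_norm_sq_eq]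
      field_simp
    · simp only [mul_pow, ← Finset.mul_sum, ← EuclideanSpace.real_norm_sq_eq]
      field_simp
    · have h₁ : ∑ q : α × β, ‖M x‖⁻¹ * M x q.1 * (‖x‖⁻¹ * x q.2) * w q
          = ‖M x‖⁻¹ * ‖x‖⁻¹ * ‖M x‖ ^ 2 := by
        rw [EuclideanSpace.real_norm_sq_eq, Fintype.sum_prod_type, Finset.mul_sum]
        refine Finset.sum_congr rfl fun a _ => ?_
        have h₂ : M x a = ∑ b, w (a, b) * x b := by
          simp [hM, Matrix.toLpLin_apply, Matrix.mulVec, dotProduct]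
        rw [pow_two, ← mul_assoc]
        conv_rhs => arg 2; rw [h₂]
        simp only [Finset.mul_sum]
        exact Finset.sum_congr rfl fun b _ => by ring
      rw [h₁, show ‖M x‖⁻¹ * ‖x‖⁻¹ * ‖M x‖ ^ 2 = ‖M x‖ / ‖x‖ by field_simp]
      rwa [lt_div_iff₀ hx₀]
  rcases isEmpty_or_nonempty U with hU | hU
  · have : E = ∅ := by
      refine Set.eq_empty_of_subset_empty (hsub.trans fun w hw => ?_)
      obtain ⟨q, -⟩ := hw
      exact hU.elim q
    rw [this]; simp; positivity
  -- The strict inequality is an open condition on the pair, so a dense sequence detects it. Its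
  -- finite initial segments give increasing events with a common bound.
  have hdense : exceedSet (fun q : U => q.1.1) (fun q : U => q.1.2) S ⊆
      ⋃ N : ℕ, exceedSet (fun k : Fin N => (TopologicalSpace.denseSeq U k).1.1)
        (fun k : Fin N => (TopologicalSpace.denseSeq U k).1.2) S := by
    rintro w ⟨q, hq⟩
    have hopen : IsOpen {q : U | S < ∑ r : α × β, q.1.1 r.1 * q.1.2 r.2 * w r} :=
      isOpen_lt continuous_const (by fun_prop)
    obtain ⟨_, h, ⟨k, rfl⟩⟩ := (TopologicalSpace.denseRange_denseSeq U).inter_open_nonempty _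
      hopen ⟨q, hq⟩
    exact Set.mem_iUnion.2 ⟨k + 1, ⟨k, Nat.lt_succ_self k⟩, h⟩
  have hmono : Monotone fun N : ℕ =>
      exceedSet (fun k : Fin N => (TopologicalSpace.denseSeq U k).1.1)
        (fun k : Fin N => (TopologicalSpace.denseSeq U k).1.2) S := by
    rintro N N' hN w ⟨k, hk⟩
    exact ⟨Fin.castLE hN k, hk⟩
  have hle : stdGauss (α × β) E ≤ ENNReal.ofReal (Real.exp (-(t ^ 2 / 2))) := by
    refine (measure_mono (hsub.trans hdense)).trans ?_
    rw [hmono.measure_iUnion]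
    refine iSup_le fun N => ?_
    rw [← ofReal_measureReal]
    exact ENNReal.ofReal_le_ofReal (measureReal_exceedSet_le ht
      (fun k => (TopologicalSpace.denseSeq U k).2.1) fun k => (TopologicalSpace.denseSeq U k).2.2)
  exact ENNReal.toReal_le_of_le_ofReal (Real.exp_pos _).le hle

end GaussianMatrix

/-! ### Weyl's inequality, and the vanishing of singular values beyond the rank. -/

section SingularValues

open Module

variable {E F : Type*} [NormedAddCommGroup E] [InnerProductSpace ℝ E] [FiniteDimensional ℝ E]
  [NormedAddCommGroup F] [InnerProductSpace ℝ F] [FiniteDimensional ℝ F]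

/-- The right singular vectors of a linear map, in the order of decreasing singular values. -/
noncomputable def rightSingularBasis (A : E →ₗ[ℝ] F) :
    OrthonormalBasis (Fin (finrank ℝ E)) ℝ E :=
  A.isSymmetric_adjoint_comp_self.eigenvectorBasis rfl

theorem norm_sq_apply_eq_sum (A : E →ₗ[ℝ] F) (x : E) :
    ‖A x‖ ^ 2 = ∑ i : Fin (finrank ℝ E), A.singularValues i ^ 2 * ((rightSingularBasis A).repr x i) ^ 2 := by
  have h₁ : ‖A x‖ ^ 2 = inner ℝ ((LinearMap.adjoint A ∘ₗ A) x) x := by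
    rw [LinearMap.comp_apply, LinearMap.adjoint_inner_left, real_inner_self_eq_norm_sq]
  rw [h₁, ← (rightSingularBasis A).repr.inner_map_map, PiLp.inner_apply]
  refine Finset.sum_congr rfl fun i _ => ?_
  rw [rightSingularBasis, LinearMap.IsSymmetric.eigenvectorBasis_apply_self_apply,
    LinearMap.sq_singularValues_fin A rfl]
  simp
  ring

theorem norm_sq_eq_sum_repr (A : E →ₗ[ℝ] F) (x : E) :
    ‖x‖ ^ 2 = ∑ i, ((rightSingularBasis A).repr x i) ^ 2 := by
  rw [← (rightSingularBasis A).repr.norm_map, EuclideanSpace.real_norm_sq_eq]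

/-- **Weyl's inequality** for singular values. -/
theorem singularValues_le_add (A B : E →ₗ[ℝ] F) {ε : ℝ} (hε : ∀ x, ‖A x - B x‖ ≤ ε * ‖x‖)
    (hε₀ : 0 ≤ ε) (k : ℕ) : A.singularValues k ≤ B.singularValues k + ε := by
  rcases le_or_gt (finrank ℝ E) k with hk | hk
  · rw [A.singularValues_of_finrank_le hk, B.singularValues_of_finrank_le hk, zero_add]
    exact hε₀
  -- Dimension count: `k` conditions remove the top singular directions of `B`, and `finrank - k -
  -- 1` conditions remove those of `A` below the index `k`. One dimension is left, and a nonzero `x`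
  -- there satisfies both `h₁` and `h₂`.
  let f : E →ₗ[ℝ] (Fin k → ℝ) × ({i : Fin (finrank ℝ E) // k < i} → ℝ) :=
    LinearMap.prod
      (LinearMap.pi fun i => (EuclideanSpace.proj (⟨i, i.2.trans hk⟩ : Fin (finrank ℝ E))).toLinearMap
        ∘ₗ (rightSingularBasis B).repr.toLinearEquiv.toLinearMap)
      (LinearMap.pi fun i => (EuclideanSpace.proj i.1).toLinearMap
        ∘ₗ (rightSingularBasis A).repr.toLinearEquiv.toLinearMap)
  have hdim : finrank ℝ ((Fin k → ℝ) × ({i : Fin (finrank ℝ E) // k < i} → ℝ)) < finrank ℝ E := by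
    rw [finrank_prod, finrank_pi, finrank_pi, Fintype.card_fin, Fintype.card_subtype]
    have : (Finset.univ.filter fun i : Fin (finrank ℝ E) => k < i)
        = Finset.Ioi (⟨k, hk⟩ : Fin (finrank ℝ E)) := by
      ext i; simp [Fin.lt_def]
    rw [this, Fin.card_Ioi]
    simp only
    omega
  obtain ⟨x, hx, hx₀⟩ := (Submodule.ne_bot_iff _).1 (LinearMap.ker_ne_bot_of_finrank_lt hdim (f := f))
  have hfx : f x = 0 := hx
  have hBx (i : Fin (finrank ℝ E)) (hi : (i : ℕ) < k) : (rightSingularBasis B).repr x i = 0 :=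
    congrFun (congrArg Prod.fst hfx) ⟨i, hi⟩
  have hAx (i : Fin (finrank ℝ E)) (hi : k < (i : ℕ)) : (rightSingularBasis A).repr x i = 0 :=
    congrFun (congrArg Prod.snd hfx) ⟨i, hi⟩
  have hnx : 0 < ‖x‖ := norm_pos_iff.2 hx₀
  have h₁ : A.singularValues k * ‖x‖ ≤ ‖A x‖ := by
    refine (sq_le_sq₀ (mul_nonneg (A.singularValues_nonneg k) (norm_nonneg _)) (norm_nonneg _)).1 ?_
    rw [mul_pow, norm_sq_apply_eq_sum, norm_sq_eq_sum_repr A, Finset.mul_sum]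
    refine Finset.sum_le_sum fun i _ => ?_
    rcases lt_or_ge k (i : ℕ) with hi | hi
    · simp [hAx i hi]
    · exact mul_le_mul_of_nonneg_right (pow_le_pow_left₀ (A.singularValues_nonneg k)
        (A.singularValues_antitone hi) 2) (sq_nonneg _)
  have h₂ : ‖B x‖ ≤ B.singularValues k * ‖x‖ := by
    refine (sq_le_sq₀ (norm_nonneg _) (mul_nonneg (B.singularValues_nonneg k) (norm_nonneg _))).1 ?_
    rw [mul_pow, norm_sq_apply_eq_sum, norm_sq_eq_sum_repr B, Finset.mul_sum]
    refine Finset.sum_le_sum fun i _ => ?_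
    rcases lt_or_ge (i : ℕ) k with hi | hi
    · simp [hBx i hi]
    · exact mul_le_mul_of_nonneg_right (pow_le_pow_left₀ (B.singularValues_nonneg i)
        (B.singularValues_antitone hi) 2) (sq_nonneg _)
  have h₃ : ‖A x‖ ≤ ‖B x‖ + ‖A x - B x‖ := by
    have := norm_add_le (B x) (A x - B x)
    rwa [add_sub_cancel] at this
  have h₄ := hε x
  refine le_of_mul_le_mul_right ?_ hnx
  rw [add_mul]
  linarith

variable {l m : Type*} [Fintype l] [Fintype m] [DecidableEq m]

theorem singularValue_le_add (k : ℕ) (M N : Matrix l m ℝ) {ε : ℝ} (hε₀ : 0 ≤ ε)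
    (hε : ∀ x, ‖Matrix.toEuclideanLin (M - N) x‖ ≤ ε * ‖x‖) :
    singularValue k M ≤ singularValue k N + ε :=
  singularValues_le_add _ _ (fun x => by simpa [map_sub] using hε x) hε₀ _

theorem singularValue_eq_zero_of_rank_lt {k : ℕ} {M : Matrix l m ℝ} (h : M.rank < k) :
    singularValue k M = 0 := by
  rw [singularValue, LinearMap.singularValues_eq_zero_iff_le_finrank_range]
  have : M.rank = finrank ℝ (Matrix.toEuclideanLin M).range := by
    rw [Matrix.rank_eq_finrank_range_toLin M (EuclideanSpace.basisFun l ℝ).toBasis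
      (EuclideanSpace.basisFun m ℝ).toBasis]
    rw [Matrix.toEuclideanLin_eq_toLin_orthonormal]
  omega

end SingularValues

/-! ### Cutting the ring at two bonds bounds the rank of a matricization. -/

section LowRank

variable {d : ℕ}

/-- If `M p q = ∑ k, f p k * g q k`, where `g` ignores the coordinates in `S` and `f` only depends on
the coordinates in `S` and on the coordinates `s` and `t`, then `M` has rank at most `r s * r t`. -/
theorem rank_le_of_eq_sum_mul {r : Fin d → ℕ} (hr : ∀ j, 0 < r j)
    {l m : Type*} [Fintype l] [Fintype m] {M : Matrix l m ℝ}
    {f : l → (∀ j, Fin (r j)) → ℝ} {g : m → (∀ j, Fin (r j)) → ℝ}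
    (hM : ∀ p q, M p q = ∑ k, f p k * g q k) (S : Fin d → Prop) [DecidablePred S] {s t : Fin d}
    (hs : ¬ S s) (ht : ¬ S t) (hst : s ≠ t)
    (hf : ∀ p k k', (∀ j, S j ∨ j = s ∨ j = t → k j = k' j) → f p k = f p k')
    (hg : ∀ q k k', (∀ j, ¬ S j → k j = k' j) → g q k = g q k') :
    M.rank ≤ r s * r t := by
  let k₀ : ∀ j, Fin (r j) := fun j => ⟨0, hr j⟩
  let φ := Equiv.piEquivPiSubtypeProd S fun j => Fin (r j)
  let mix (a : ∀ j : {j // S j}, Fin (r j)) (k : ∀ j, Fin (r j)) : ∀ j, Fin (r j) :=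
    φ.symm (a, fun j => k j)
  have mix_of_not (a) (k) (j) (hj : ¬ S j) : mix a k j = k j := by simp [mix, φ, hj]
  -- The factorization passes through the values `κ` of the two cut bonds: `A` sums over the bonds
  -- in `S`, and `B` over the others that agree with `κ`. The values of `k₀` are fillers at
  -- coordinates that do not matter.
  let A : Matrix l (Fin (r s) × Fin (r t)) ℝ := Matrix.of fun p κ =>
    ∑ a, f p (mix a (Function.update (Function.update k₀ s κ.1) t κ.2))
  let B : Matrix (Fin (r s) × Fin (r t)) m ℝ := Matrix.of fun κ q =>
    ∑ b : ∀ j : {j // ¬ S j}, Fin (r j),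
      if (b ⟨s, hs⟩, b ⟨t, ht⟩) = κ then g q (φ.symm (fun j => k₀ j, b)) else 0
  have hAB : M = A * B := by
    ext p q
    rw [hM, ← φ.symm.sum_comp fun k => f p k * g q k, Fintype.sum_prod_type_right, Matrix.mul_apply]
    simp only [A, B, Matrix.of_apply, Finset.mul_sum, mul_ite, mul_zero]
    conv_rhs => rw [Finset.sum_comm]
    refine Finset.sum_congr rfl fun b _ => ?_
    rw [Finset.sum_ite_eq]
    simp only [Finset.mem_univ, if_true, Finset.sum_mul]
    refine Finset.sum_congr rfl fun a _ => ?_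
    congr 1
    · refine hf p _ _ fun j hj => ?_
      rcases hj with hj | rfl | rfl
      · simp [mix, φ, hj]
      · rw [mix_of_not _ _ _ hs]
        simp [φ, hs, hst]
      · rw [mix_of_not _ _ _ ht]
        simp [φ, ht]
    · exact hg q _ _ fun j hj => by simp [φ, hj]
  rw [hAB]
  refine (Matrix.rank_mul_le_left A B).trans ((Matrix.rank_le_card_width A).trans ?_)
  simp

theorem val_add_one_eq [NeZero d] (j : Fin d) :
    ((j + 1 : Fin d) : ℕ) = if (j : ℕ) + 1 < d then (j : ℕ) + 1 else 0 := by
  have hj := j.isLt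
  rw [Fin.val_add, Fin.val_one', Nat.add_mod_mod]
  split_ifs with h
  · exact Nat.mod_eq_of_lt h
  · rw [show (j : ℕ) + 1 = d by omega, Nat.mod_self]

theorem update_four_comm {n : Fin d → ℕ} (y : ∀ j, Fin (n j)) {a b c e : Fin d}
    (hac : a ≠ c) (hae : a ≠ e) (hbc : b ≠ c) (hbe : b ≠ e) (pa : Fin (n a)) (pb : Fin (n b))
    (pc : Fin (n c)) (pe : Fin (n e)) :
    Function.update (Function.update (Function.update (Function.update y a pa) b pb) c pc) e pe
      = Function.update (Function.update (Function.update (Function.update y c pc) e pe) a pa) b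
        pb := by
  rw [Function.update_comm hbc, Function.update_comm hac, Function.update_comm hbe,
    Function.update_comm hae]

theorem matricization_swap {n : Fin d → ℕ} (X : Tensor n) (y : ∀ j, Fin (n j)) {a b c e : Fin d}
    (hac : a ≠ c) (hae : a ≠ e) (hbc : b ≠ c) (hbe : b ≠ e) :
    matricization X y c e a b = (matricization X y a b c e).transpose := by
  ext q p
  simp only [matricization, Matrix.of_apply, Matrix.transpose_apply]
  rw [update_four_comm y hac hae hbc hbe]

/-- A matricization of a tensor ring whose row indices sit at positions in `[lo, hi]` and whose
column indices do not has rank at most the product of the two bond dimensions at the ends. -/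
theorem rank_matricization_lt_of_arc [NeZero d] {r n : Fin d → ℕ} (τ : Equiv.Perm (Fin d))
    (u : Cores r n τ) {R : ℕ} (hdim : DimensionCondition R r n) (y : ∀ j, Fin (n j))
    {a b c e : Fin d} {lo hi : ℕ} (hlo : lo ≤ hi) (hhi : hi + 1 < d)
    (ha : lo ≤ τ.symm a ∧ τ.symm a ≤ hi) (hb : lo ≤ τ.symm b ∧ τ.symm b ≤ hi)
    (hc : ¬ (lo ≤ τ.symm c ∧ τ.symm c ≤ hi)) (he : ¬ (lo ≤ τ.symm e ∧ τ.symm e ≤ hi)) :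
    (matricization (ringTensor τ u) y a b c e).rank < R ^ 4 := by
  obtain ⟨hR, -, hr, hr'⟩ := hdim
  let Q : Fin d → Prop := fun i => lo ≤ τ.symm i ∧ τ.symm i ≤ hi
  -- The core at position `j` touches the bonds `j` and `j + 1`. The arc from `lo` to `hi` therefore
  -- meets the other cores only through the bonds `lo` and `hi + 1`; the bonds `j` with `lo < j ≤
  -- hi` are interior to it.
  let s : Fin d := ⟨lo, by omega⟩
  let t : Fin d := ⟨hi + 1, hhi⟩
  let f : Fin (n a) × Fin (n b) → (∀ j, Fin (r j)) → ℝ := fun p k => ∏ i, if Q i then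
    u i (k (τ.symm i)) (Function.update (Function.update y a p.1) b p.2 i) (k (τ.symm i + 1)) else 1
  let g : Fin (n c) × Fin (n e) → (∀ j, Fin (r j)) → ℝ := fun q k => ∏ i, if Q i then 1 else
    u i (k (τ.symm i)) (Function.update (Function.update y c q.1) e q.2 i) (k (τ.symm i + 1))
  have hrank : (matricization (ringTensor τ u) y a b c e).rank ≤ r s * r t := by
    refine rank_le_of_eq_sum_mul (fun j => lt_of_lt_of_le hR (hr' j)) (f := f) (g := g) ?_
      (fun j : Fin d => lo < (j : ℕ) ∧ (j : ℕ) ≤ hi) (by simp [s]) (by simp [t])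
      (by simp [s, t]; omega) ?_ ?_
    · intro p q
      simp only [matricization, Matrix.of_apply, ringTensor, f, g]
      refine Finset.sum_congr rfl fun k _ => ?_
      rw [← Finset.prod_mul_distrib]
      refine Finset.prod_congr rfl fun i _ => ?_
      by_cases hi : Q i
      · have hic : i ≠ c := by rintro rfl; exact hc hi
        have hie : i ≠ e := by rintro rfl; exact he hi
        rw [if_pos hi, if_pos hi, mul_one, Function.update_of_ne hie, Function.update_of_ne hic]
      · have hia : i ≠ a := by rintro rfl; exact hi ha
        have hib : i ≠ b := by rintro rfl; exact hi hb
        rw [if_neg hi, if_neg hi, one_mul]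
        rw [update_four_comm y (by rintro rfl; exact hc ha) (by rintro rfl; exact he ha)
          (by rintro rfl; exact hc hb) (by rintro rfl; exact he hb), Function.update_of_ne hib,
          Function.update_of_ne hia]
    · intro p k k' h
      refine Finset.prod_congr rfl fun i _ => ?_
      by_cases hi : Q i
      · have h₁ := val_add_one_eq (τ.symm i)
        rw [if_pos hi, if_pos hi, h (τ.symm i), h (τ.symm i + 1)]
        · simp only [Fin.ext_iff, h₁, s, t]
          obtain ⟨h₂, h₃⟩ := hi
          split_ifs <;> omega
        · simp only [Fin.ext_iff, s]
          obtain ⟨h₂, h₃⟩ := hi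
          omega
      · rw [if_neg hi, if_neg hi]
    · intro q k k' h
      refine Finset.prod_congr rfl fun i _ => ?_
      by_cases hi : Q i
      · rw [if_pos hi, if_pos hi]
      · have h₁ := val_add_one_eq (τ.symm i)
        rw [if_neg hi, if_neg hi, h (τ.symm i), h (τ.symm i + 1)]
        · rw [h₁]
          simp only [Q] at hi
          split_ifs <;> omega
        · simp only [Q] at hi
          omega
  calc _ ≤ r s * r t := hrank
    _ < R ^ 2 * R ^ 2 := Nat.mul_lt_mul'' (hr s) (hr t)
    _ = R ^ 4 := by ring

/-- `x` and `y` lie in an interval that avoids `z` and `w` and does not contain the largest of the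
four numbers. -/
def Separated (x y z w : ℕ) : Prop :=
  max x y < max z w ∧ (z < min x y ∨ max x y < z) ∧ (w < min x y ∨ max x y < w)

/-- Transposition exchanges the two pairs without changing the rank, so the pair that avoids the
largest position can always supply the rows. Its arc then does not wrap around. -/
theorem rank_matricization_lt [NeZero d] {r n : Fin d → ℕ} (τ : Equiv.Perm (Fin d))
    (u : Cores r n τ) {R : ℕ} (hdim : DimensionCondition R r n) (y : ∀ j, Fin (n j))
    {a b c e : Fin d}
    (h : Separated (τ.symm a) (τ.symm b) (τ.symm c) (τ.symm e) ∨
      Separated (τ.symm c) (τ.symm e) (τ.symm a) (τ.symm b)) :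
    (matricization (ringTensor τ u) y a b c e).rank < R ^ 4 := by
  have key {a b c e : Fin d} (h : Separated (τ.symm a) (τ.symm b) (τ.symm c) (τ.symm e)) :
      (matricization (ringTensor τ u) y a b c e).rank < R ^ 4 := by
    obtain ⟨h₁, h₂, h₃⟩ := h
    have := (τ.symm c).isLt
    have := (τ.symm e).isLt
    exact rank_matricization_lt_of_arc τ u hdim y (lo := min (τ.symm a) (τ.symm b))
      (hi := max (τ.symm a) (τ.symm b)) (by omega) (by omega) (by omega) (by omega) (by omega)
      (by omega)
  rcases h with h | h
  · exact key h
  · have hne {i j : Fin d} (hij : (τ.symm i : ℕ) ≠ τ.symm j) : i ≠ j := by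
      rintro rfl; exact hij rfl
    rw [matricization_swap (a := c) (b := e) (c := a) (e := b), Matrix.rank_transpose]
    · exact key h
    all_goals
      obtain ⟨h₁, h₂, h₃⟩ := h
      exact hne (by omega)

end LowRank

/-! ### Cyclic orders of four points. -/

section Order

variable {d : ℕ} {τ : Equiv.Perm (Fin d)} {i : Fin 4 → Fin d}

/-- Cyclically adjacent pairs do not interleave with their complements. Of two complementary pairs,
the one without the largest position fills an interval free of the other. -/
theorem CorrectOrder.separated (h : CorrectOrder τ i) :
    (Separated (τ.symm (i 0)) (τ.symm (i 1)) (τ.symm (i 2)) (τ.symm (i 3)) ∨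
      Separated (τ.symm (i 2)) (τ.symm (i 3)) (τ.symm (i 0)) (τ.symm (i 1))) ∧
    (Separated (τ.symm (i 0)) (τ.symm (i 3)) (τ.symm (i 1)) (τ.symm (i 2)) ∨
      Separated (τ.symm (i 1)) (τ.symm (i 2)) (τ.symm (i 0)) (τ.symm (i 3))) := by
  obtain ⟨s, h⟩ := h
  simp only [Fin.lt_def, gt_iff_lt] at h
  simp only [Separated]
  fin_cases s <;> simp only [Fin.reduceFinMk, Fin.zero_eta, Fin.mk_one, Fin.isValue,
    Fin.reduceAdd, zero_add] at h <;> omega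

theorem Separated.symm_left {x y z w : ℕ} (h : Separated x y z w) : Separated y x z w := by
  unfold Separated at *; omega

theorem Separated.symm_right {x y z w : ℕ} (h : Separated x y z w) : Separated x y w z := by
  unfold Separated at *; omega

/-- Up to rotation and reversal, a cyclic order of four points is determined by which point lies
opposite `i 0`; the three alternatives correspond to `i 2`, `i 1` and `i 3`. -/
theorem exists_correctOrder (hi : Function.Injective i) :
    CorrectOrder τ i ∨ CorrectOrder τ ![i 0, i 2, i 1, i 3] ∨
      CorrectOrder τ ![i 0, i 1, i 3, i 2] := by
  have hne (a b : Fin 4) (hab : a ≠ b) : τ.symm (i a) ≠ τ.symm (i b) := fun h =>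
    hab (hi (τ.symm.injective h))
  have h₁ := hne 0 1 (by decide)
  have h₂ := hne 0 2 (by decide)
  have h₃ := hne 0 3 (by decide)
  have h₄ := hne 1 2 (by decide)
  have h₅ := hne 1 3 (by decide)
  have h₆ := hne 2 3 (by decide)
  simp only [CorrectOrder, Fin.exists_fin_succ, gt_iff_lt]
  simp
  generalize τ.symm (i 0) = x at *
  generalize τ.symm (i 1) = y at *
  generalize τ.symm (i 2) = z at *
  generalize τ.symm (i 3) = w at *
  clear hne
  rcases lt_or_gt_of_ne h₁ with h₁ | h₁ <;> rcases lt_or_gt_of_ne h₂ with h₂ | h₂ <;>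
  rcases lt_or_gt_of_ne h₃ with h₃ | h₃ <;> rcases lt_or_gt_of_ne h₄ with h₄ | h₄ <;>
  rcases lt_or_gt_of_ne h₅ with h₅ | h₅ <;> rcases lt_or_gt_of_ne h₆ with h₆ | h₆ <;>
  first | (exfalso; order) | simp [*]

end Order

/-! ### Correctness of the algorithm under small noise. -/

section Algorithm

variable {d : ℕ} {n : Fin d → ℕ}

/-- `ε` bounds the operator norms of the three matricizations used by the algorithm. -/
def MatricizationsBounded (N : Tensor n) (y : ∀ j, Fin (n j)) (i : Fin 4 → Fin d) (ε : ℝ) : Prop :=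
  (∀ x, ‖Matrix.toEuclideanLin (matricization N y (i 0) (i 1) (i 2) (i 3)) x‖ ≤ ε * ‖x‖) ∧
  (∀ x, ‖Matrix.toEuclideanLin (matricization N y (i 0) (i 2) (i 1) (i 3)) x‖ ≤ ε * ‖x‖) ∧
  (∀ x, ‖Matrix.toEuclideanLin (matricization N y (i 0) (i 3) (i 1) (i 2)) x‖ ≤ ε * ‖x‖)

theorem singularValue_matricization_add_le (k : ℕ) (X N : Tensor n) (y : ∀ j, Fin (n j))
    {a b c e : Fin d} {ε : ℝ} (hε₀ : 0 ≤ ε)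
    (hε : ∀ x, ‖Matrix.toEuclideanLin (matricization N y a b c e) x‖ ≤ ε * ‖x‖) :
    singularValue k (matricization (fun x => X x + N x) y a b c e)
        ≤ singularValue k (matricization X y a b c e) + ε ∧
      singularValue k (matricization X y a b c e)
        ≤ singularValue k (matricization (fun x => X x + N x) y a b c e) + ε := by
  have h : matricization (fun x => X x + N x) y a b c e - matricization X y a b c e
      = matricization N y a b c e := by
    ext p q; simp [matricization]
  refine ⟨singularValue_le_add k _ _ hε₀ fun x => ?_, singularValue_le_add k _ _ hε₀ fun x => ?_⟩
  · rw [h]; exact hε x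
  · rw [← neg_sub, h, map_neg, LinearMap.neg_apply, norm_neg]; exact hε x

/-- The algorithm succeeds when the noise is smaller than half the singular value bound. -/
theorem fourIndexAlgorithm_correct [NeZero d] {r : Fin d → ℕ} (τ : Equiv.Perm (Fin d))
    (u : Cores r n τ) {R : ℕ} (hdim : DimensionCondition R r n) {σ : ℝ}
    (hbound : UniformSingularValueBound τ (ringTensor τ u) R σ) {i : Fin 4 → Fin d}
    (hi : Function.Injective i) (y : ∀ j, Fin (n j)) {N : Tensor n} {ε : ℝ} (hε₀ : 0 ≤ ε)
    (hεσ : 2 * ε < σ) (hN : MatricizationsBounded N y i ε) :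
    ∃ o : Fin 4 → Fin d,
      fourIndexAlgorithm R i y (fun x => ringTensor τ u x + N x) = some o ∧ CorrectOrder τ o := by
  obtain ⟨h₁, h₂, h₃⟩ := hN
  have w₁ := singularValue_matricization_add_le (R ^ 4) (ringTensor τ u) N y hε₀ h₁
  have w₂ := singularValue_matricization_add_le (R ^ 4) (ringTensor τ u) N y hε₀ h₂
  have w₃ := singularValue_matricization_add_le (R ^ 4) (ringTensor τ u) N y hε₀ h₃
  have low {a b c e : Fin d}
      (h : Separated (τ.symm a) (τ.symm b) (τ.symm c) (τ.symm e) ∨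
        Separated (τ.symm c) (τ.symm e) (τ.symm a) (τ.symm b)) :
      singularValue (R ^ 4) (matricization (ringTensor τ u) y a b c e) = 0 :=
    singularValue_eq_zero_of_rank_lt (rank_matricization_lt τ u hdim y h)
  simp only [fourIndexAlgorithm]
  -- In each case the crossing matricization keeps a value of at least `σ - ε > ε`, while the other
  -- two start at zero and reach at most `ε`.
  rcases exists_correctOrder (τ := τ) hi with h | h | h
  · have b₂ := hbound _ h y
    have z₁ := low h.separated.1
    have z₃ := low h.separated.2
    refine ⟨_, ?_, h⟩
    rw [if_neg (by rw [gt_iff_lt, max_lt_iff]; intro hc; linarith [hc.1]),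
      if_pos (max_lt (by linarith) (by linarith))]
    congr 1
    ext j; fin_cases j <;> rfl
  -- The crossing pairing of the reordered tuple `![i 0, i 2, i 1, i 3]` is `(i 0, i 1), (i 2, i
  -- 3)`, the one behind `s₁`.
  · have b₁ : σ ≤ singularValue (R ^ 4) (matricization (ringTensor τ u) y (i 0) (i 1) (i 2) (i 3)) :=
      hbound _ h y
    have z₂ := low (a := i 0) (b := i 2) (c := i 1) (e := i 3) h.separated.1
    have z₃ := low (a := i 0) (b := i 3) (c := i 1) (e := i 2)
      (h.separated.2.imp Separated.symm_right Separated.symm_left)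
    refine ⟨_, ?_, h⟩
    rw [if_pos (max_lt (by linarith) (by linarith))]
  · have b₃ : σ ≤ singularValue (R ^ 4) (matricization (ringTensor τ u) y (i 0) (i 3) (i 1) (i 2)) :=
      hbound _ h y
    have z₁ := low (a := i 0) (b := i 1) (c := i 2) (e := i 3)
      (h.separated.1.imp Separated.symm_right Separated.symm_left)
    have z₂ := low (a := i 0) (b := i 2) (c := i 1) (e := i 3) h.separated.2
    refine ⟨_, ?_, h⟩
    rw [if_neg (by rw [gt_iff_lt, max_lt_iff]; intro hc; linarith [hc.2]),
      if_neg (by rw [gt_iff_lt, max_lt_iff]; intro hc; linarith [hc.2]),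
      if_pos (max_lt (by linarith) (by linarith))]

end Algorithm

/-! ### The noise matricizations as scaled Gaussian matrices. -/

section Noise

variable {d : ℕ} {n : Fin d → ℕ} {Ω : Type*} [MeasurableSpace Ω] {P : Measure Ω}
  {noise : (∀ j : Fin d, Fin (n j)) → Ω → ℝ} {σe : ℝ}

/-- Distinct matrix entries are distinct tensor entries; this is why the noise in a matricization is
independent. -/
theorem update_four_injective (y : ∀ j, Fin (n j)) {a b c e : Fin d} (hab : a ≠ b) (hac : a ≠ c)
    (hae : a ≠ e) (hbc : b ≠ c) (hbe : b ≠ e) (hce : c ≠ e) :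
    Function.Injective fun q : (Fin (n a) × Fin (n b)) × (Fin (n c) × Fin (n e)) =>
      Function.update (Function.update (Function.update (Function.update y
        a q.1.1) b q.1.2) c q.2.1) e q.2.2 := by
  rintro ⟨⟨p₁, p₂⟩, p₃, p₄⟩ ⟨⟨q₁, q₂⟩, q₃, q₄⟩ h
  have ha := congrFun h a
  have hb := congrFun h b
  have hc := congrFun h c
  have he := congrFun h e
  simp only [Function.update_self, Function.update_of_ne hab, Function.update_of_ne hac,
    Function.update_of_ne hae, Function.update_of_ne hbc, Function.update_of_ne hbe,
    Function.update_of_ne hce] at ha hb hc he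
  rw [ha, hb, hc, he]

theorem hasLaw_noise_div (hσe : 0 < σe)
    (hlaw : ∀ x, HasLaw (noise x) (gaussianReal 0 (σe ^ 2).toNNReal) P) (hindep : iIndepFun noise P)
    {κ : Type*} [Fintype κ] {idx : κ → ∀ j : Fin d, Fin (n j)} (hidx : Function.Injective idx) :
    HasLaw (fun ω k => noise (idx k) ω / σe) (stdGauss κ) P := by
  have hX (k : κ) : HasLaw (fun ω => noise (idx k) ω / σe) (gaussianReal 0 1) P := by
    have h := gaussianReal_div_const (hlaw (idx k)) σe
    convert h using 2
    · simp
    · rw [eq_div_iff (by intro h0; exact hσe.ne' (by simpa using congrArg NNReal.toReal h0)),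
        one_mul]
      exact NNReal.eq (by simp [sq_nonneg])
  have hind : iIndepFun (fun k ω => noise (idx k) ω / σe) P :=
    (hindep.precomp hidx).comp (fun _ x => x / σe) fun _ => by fun_prop
  refine ⟨aemeasurable_pi_lambda _ fun k => (hX k).aemeasurable, ?_⟩
  rw [hind.map_fun_eq_pi_map fun k => (hX k).aemeasurable]
  simp only [(hX _).map_eq]

theorem measureReal_norm_matricization_noise_le [IsProbabilityMeasure P] (hσe : 0 < σe)
    (hlaw : ∀ x, HasLaw (noise x) (gaussianReal 0 (σe ^ 2).toNNReal) P) (hindep : iIndepFun noise P)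
    (y : ∀ j, Fin (n j)) {a b c e : Fin d} (hab : a ≠ b) (hac : a ≠ c) (hae : a ≠ e) (hbc : b ≠ c)
    (hbe : b ≠ e) (hce : c ≠ e) {t ε : ℝ} (ht : 0 < t)
    (hε : σe * (2 * ((Finset.univ.sup n : ℕ) : ℝ) + t) ≤ ε) :
    P.real {ω | ¬ ∀ x, ‖Matrix.toEuclideanLin
        (matricization (fun x => noise x ω) y a b c e) x‖ ≤ ε * ‖x‖}
      ≤ Real.exp (-(t ^ 2 / 2)) := by
  have law := hasLaw_noise_div hσe hlaw hindep (update_four_injective y hab hac hae hbc hbe hce)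
  have : Nonempty (Fin (n a)) := ⟨y a⟩
  have : Nonempty (Fin (n b)) := ⟨y b⟩
  have : Nonempty (Fin (n c)) := ⟨y c⟩
  have : Nonempty (Fin (n e)) := ⟨y e⟩
  have tail := measureReal_norm_gaussianMatrix_le (α := Fin (n a) × Fin (n b))
    (β := Fin (n c) × Fin (n e)) ht
  -- The matrix sides are products of two dimensions, so each square root is at most the maximal
  -- dimension. This is the source of the term `2 * Finset.univ.sup n`.
  have hsq (j k : Fin d) :
      √(Fintype.card (Fin (n j) × Fin (n k)) : ℝ) ≤ ((Finset.univ.sup n : ℕ) : ℝ) := by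
    refine Real.sqrt_le_iff.2 ⟨by positivity, ?_⟩
    rw [pow_two, Fintype.card_prod, Fintype.card_fin, Fintype.card_fin]
    exact_mod_cast Nat.mul_le_mul (Finset.le_sup (f := n) (Finset.mem_univ j))
      (Finset.le_sup (f := n) (Finset.mem_univ k))
  refine le_trans ?_ tail
  rw [← law.map_eq]
  -- The inequality between the measure of a preimage and the pushforward measure needs no
  -- measurability of the event.
  refine ENNReal.toReal_mono (measure_ne_top _ _) ((measure_mono ?_).trans
    (Measure.le_map_apply law.aemeasurable _))
  intro ω hω
  simp only [Set.mem_preimage, Set.mem_ofPred_eq] at hω ⊢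
  contrapose! hω
  intro x
  have hmat : matricization (fun x => noise x ω) y a b c e
      = σe • Matrix.of fun p q => noise (Function.update (Function.update (Function.update
        (Function.update y a p.1) b p.2) c q.1) e q.2) ω / σe := by
    ext p q
    simp [matricization]
    field_simp
  rw [hmat, map_smul, LinearMap.smul_apply, norm_smul, Real.norm_of_nonneg hσe.le]
  calc _ ≤ σe * ((√(Fintype.card (Fin (n a) × Fin (n b)))
        + √(Fintype.card (Fin (n c) × Fin (n e))) + t) * ‖x‖) :=
        mul_le_mul_of_nonneg_left (hω x) hσe.le
    _ ≤ σe * ((2 * ((Finset.univ.sup n : ℕ) : ℝ) + t) * ‖x‖) := by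
        have := hsq a b
        have := hsq c e
        gcongr
        linarith
    _ ≤ ε * ‖x‖ := by
        rw [← mul_assoc]
        exact mul_le_mul_of_nonneg_right hε (norm_nonneg x)

end Noise

end TensorRing

/-! ### Choice of the noise threshold and the union bound. -/

theorem theorem4p5 {d : ℕ} [NeZero d] {r n : Fin d → ℕ} (τ : Equiv.Perm (Fin d))
    (u : Cores r n τ) (R : ℕ) (hdim : DimensionCondition R r n)
    (σ : ℝ) (hσ : 0 < σ) (hbound : UniformSingularValueBound τ (ringTensor τ u) R σ)
    (σe : ℝ) (hσe : 0 < σe)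
    {Ω : Type*} [MeasurableSpace Ω] (P : Measure Ω) [IsProbabilityMeasure P]
    (noise : (∀ j : Fin d, Fin (n j)) → Ω → ℝ)
    (hlaw : ∀ x, HasLaw (noise x) (gaussianReal 0 (σe ^ 2).toNNReal) P)
    (hindep : iIndepFun noise P)
    (T : ℝ) (hT : T < σ / σe)
    (i : Fin 4 → Fin d) (hi : Function.Injective i) (y : ∀ j : Fin d, Fin (n j)) :
    P.real {ω | ¬ ∃ o : Fin 4 → Fin d,
        fourIndexAlgorithm R i y (fun x => ringTensor τ u x + noise x ω) = some o ∧
          CorrectOrder τ o} ≤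
      6 * Real.exp (-(1 / 8) * (max (T - 4 * ((Finset.univ.sup n : ℕ) : ℝ)) 0) ^ 2) := by
  set K : ℝ := ((Finset.univ.sup n : ℕ) : ℝ) with hK
  have hK₀ : 0 ≤ K := by positivity
  rcases le_or_gt (T - 4 * K) 0 with hT₀ | hT₀
  -- Here the claimed bound is `6`, which exceeds every probability.
  · rw [max_eq_right hT₀]
    refine measureReal_le_one.trans ?_
    norm_num
  rw [max_eq_left hT₀.le]
  -- This `t` makes `σe * (2 * K + t)` equal to `ε = T * σe / 2`, so that `2 * ε = T * σe < σ`;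
  -- moreover `t ^ 2 / 2 = (T - 4 * K) ^ 2 / 8`.
  set t : ℝ := (T - 4 * K) / 2 with ht
  have ht₀ : 0 < t := by positivity
  set ε : ℝ := T * σe / 2 with hε
  have hε₀ : 0 ≤ ε := by
    have : 0 < T := by linarith
    positivity
  have hεσ : 2 * ε < σ := by
    rw [lt_div_iff₀ hσe] at hT
    linarith
  have hle : σe * (2 * K + t) ≤ ε := le_of_eq (by rw [ht, hε]; ring)
  have hne {a b : Fin 4} (hab : a ≠ b) : i a ≠ i b := hi.ne hab
  have bound {a b c e : Fin d} (hab : a ≠ b) (hac : a ≠ c) (hae : a ≠ e) (hbc : b ≠ c)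
      (hbe : b ≠ e) (hce : c ≠ e) :=
    measureReal_norm_matricization_noise_le hσe hlaw hindep y hab hac hae hbc hbe hce ht₀ hle
  have h₁ := bound (hne (show (0 : Fin 4) ≠ 1 by decide)) (hne (show (0 : Fin 4) ≠ 2 by decide))
    (hne (show (0 : Fin 4) ≠ 3 by decide)) (hne (show (1 : Fin 4) ≠ 2 by decide))
    (hne (show (1 : Fin 4) ≠ 3 by decide)) (hne (show (2 : Fin 4) ≠ 3 by decide))
  have h₂ := bound (hne (show (0 : Fin 4) ≠ 2 by decide)) (hne (show (0 : Fin 4) ≠ 1 by decide))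
    (hne (show (0 : Fin 4) ≠ 3 by decide)) (hne (show (2 : Fin 4) ≠ 1 by decide))
    (hne (show (2 : Fin 4) ≠ 3 by decide)) (hne (show (1 : Fin 4) ≠ 3 by decide))
  have h₃ := bound (hne (show (0 : Fin 4) ≠ 3 by decide)) (hne (show (0 : Fin 4) ≠ 1 by decide))
    (hne (show (0 : Fin 4) ≠ 2 by decide)) (hne (show (3 : Fin 4) ≠ 1 by decide))
    (hne (show (3 : Fin 4) ≠ 2 by decide)) (hne (show (1 : Fin 4) ≠ 2 by decide))
  have hexp : Real.exp (-(1 / 8) * (T - 4 * K) ^ 2) = Real.exp (-(t ^ 2 / 2)) := by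
    congr 1; rw [ht]; ring
  rw [hexp]
  refine (measureReal_mono (fun ω hω => ?_)).trans ((measureReal_union_le _ _).trans
    ((add_le_add ((measureReal_union_le _ _).trans (add_le_add h₁ h₂)) h₃).trans ?_))
  · simp only [Set.mem_union, Set.mem_ofPred_eq] at hω ⊢
    by_contra! hc
    exact hω (fourIndexAlgorithm_correct τ u hdim hbound hi y hε₀ hεσ
      (N := fun x => noise x ω) ⟨hc.1.1, hc.1.2, hc.2⟩)
  -- The union over the three matricizations costs a factor `3`, which leaves room below the stated
  -- `6`.
  · linarith [Real.exp_pos (-(t ^ 2 / 2))]
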